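/- Let $T>0$ and let $y,z\in C^1([0,T])$ with $y(\tau)<z(\tau)$ for all $\tau\in[0,T]$; put $l(\tau)=z(\tau)-y(\tau)$. Let $f^-,f^+$ be continuous on $[0,T]$. Let $U$ be a bounded classical solution of $$U_\tau=U_{xx}\quad(0<\tau\le T,\ y(\tau)<x<z(\tau)),\qquad U(0,x)=U_0(x)\quad (y(0)<x<z(0)),$$ $$U(\tau,y(\tau))=f^-(\tau),\qquad U(\tau,z(\tau))=f^+(\tau)\quad(0<\tau\le T),$$ that is: $U$ is bounded, and continuous on the closed strip $0\le\tau\le T$, $y(\tau)\le x\le z(\tau)$ except possibly at its two corners at $\tau=0$; $U_\tau$ and $U_{xx}$ exist and are continuous for $0<\tau\le T$, $y(\tau)<x<z(\tau)$ (at $\tau=T$, $U_\tau$ is the left derivative); and $U_x$ exists and is continuous up to the moving boundaries for $0<\tau\le T$. Suppose that the boundary gradients $$\Psi(\tau)=-U_x(\tau,x)\big|_{x=y(\tau)},\qquad \Phi(\tau)=U_x(\tau,x)\big|_{x=z(\tau)}$$ (one-sided derivatives) are integrable on $(0,T)$. Define $$\beta(\tau,s,n)=f^-(s)\Big(\tfrac{\pi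 n}{l(\tau)}\cos\tfrac{\pi n[y(s)-y(\tau)]}{l(\tau)}-y'(s)\sin\tfrac{\pi n[y(s)-y(\tau)]}{l(\tau)}\Big)-f^+(s)\Big(\tfrac{\pi n}{l(\tau)}\cos\tfrac{\pi n[z(s)-y(\tau)]}{l(\tau)}-z'(s)\sin\tfrac{\pi n[z(s)-y(\tau)]}{l(\tau)}\Big),$$ and $F(\tau,y(\tau))=f^-(\tau)$, $F(\tau,z(\tau))=f^+(\tau)$, $F(\tau,x)=0$ for $y(\tau)<x<z(\tau)$. Then for all $0<\tau\le T$ and $y(\tau)\le x\le z(\tau)$: (i) the integrals below converge absolutely, the series converges (as the limit of its partial sums), and $$U(\tau,x)=\frac{2}{l(\tau)}\sum_{n=1}^\infty\sin\Big(\pi n\frac{x-y(\tau)}{l(\tau)}\Big)\Big\{e^{-\frac{\pi^2n^2}{l^2(\tau)}\tau}\int_{y(0)}^{z(0)}U_0(\xi)\sin\Big(\frac{\pi n}{l(\tau)}[\xi-y(\tau)]\Big)d\xi$$ $$\qquad+\int_0^\tau e^{-\frac{\pi^2n^2}{l^2(\tau)}(\tau-s)}\Big[\Phi(s)\sin\Big(\frac{\pi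 n}{l(\tau)}[z(s)-y(\tau)]\Big)+\Psi(s)\sin\Big(\frac{\pi n}{l(\tau)}[y(s)-y(\tau)]\Big)+\beta(\tau,s,n)\Big]ds\Big\}+F(\tau,x);$$ (ii) with $\theta_3(v,\omega)=1+2\sum_{n\ge1}\omega^{n^2}\cos(2nv)$, $\theta_3'=\partial\theta_3/\partial v$, $\omega_1=e^{-\pi^2\tau/l^2(\tau)}$, $\omega_2=e^{-\pi^2(\tau-s)/l^2(\tau)}$, $\phi_-(x,\xi)=\frac{\pi(x-\xi)}{2l(\tau)}$, $\phi_+(x,\xi)=\frac{\pi(x+\xi-2y(\tau))}{2l(\tau)}$, the integrals below converge absolutely and $$2l(\tau)\,[U(\tau,x)-F(\tau,x)]=\int_{y(0)}^{z(0)}U_0(\xi)\,[\theta_3(\phi_-(x,\xi),\omega_1)-\theta_3(\phi_+(x,\xi),\omega_1)]\,d\xi$$ $$+\int_0^\tau\Big\{[\Psi(s)-f^-(s)y'(s)]\,[\theta_3(\phi_-(x,y(s)),\omega_2)-\theta_3(\phi_+(x,y(s)),\omega_2)]$$ $$+[\Phi(s)+f^+(s)z'(s)]\,[\theta_3(\phi_-(x,z(s)),\omega_2)-\theta_3(\phi_+(x,z(s)),\omega_2)]$$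 $$+\frac{\pi}{2l(\tau)}\Big[f^+(s)\,[\theta_3'(\phi_-(x,z(s)),\omega_2)+\theta_3'(\phi_+(x,z(s)),\omega_2)]-f^-(s)\,[\theta_3'(\phi_-(x,y(s)),\omega_2)+\theta_3'(\phi_+(x,y(s)),\omega_2)]\Big]\Big\}\,ds.$$ -/

import Mathlib

open Real Set Filter Topology MeasureTheory

namespace MovingStrip

noncomputable section

/-- The points `(τ, x)` with `0 < τ ≤ T` and `y(τ) < x < z(τ)`. -/
def interiorStrip (T : ℝ) (y z : ℝ → ℝ) : Set (ℝ × ℝ) :=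
  {p | 0 < p.1 ∧ p.1 ≤ T ∧ y p.1 < p.2 ∧ p.2 < z p.1}

/-- The points `(τ, x)` with `0 < τ ≤ T` and `y(τ) ≤ x ≤ z(τ)`: the two moving boundaries are
included, the initial time is not. -/
def lateralStrip (T : ℝ) (y z : ℝ → ℝ) : Set (ℝ × ℝ) :=
  {p | 0 < p.1 ∧ p.1 ≤ T ∧ y p.1 ≤ p.2 ∧ p.2 ≤ z p.1}

/-- The bottom `τ = 0`, `y(0) < x < z(0)` of the strip, without its two end points. -/
def bottom (y z : ℝ → ℝ) : Set (ℝ × ℝ) :=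
  {p | p.1 = 0 ∧ y 0 < p.2 ∧ p.2 < z 0}

/-- The spatial derivative `U_x(τ, x)`, taken within `[y(τ), z(τ)]`: the ordinary derivative at
interior points, and the one-sided derivative at `x = y(τ)` and at `x = z(τ)`. -/
def spaceDeriv (y z : ℝ → ℝ) (U : ℝ → ℝ → ℝ) (τ x : ℝ) : ℝ :=
  derivWithin (U τ) (Icc (y τ) (z τ)) x

/-- The lower boundary gradient `Ψ(τ) = - U_x(τ, y(τ))`. -/
def Psi (y z : ℝ → ℝ) (U : ℝ → ℝ → ℝ) (τ : ℝ) : ℝ := -spaceDeriv y z U τ (y τ)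

/-- The upper boundary gradient `Φ(τ) = U_x(τ, z(τ))`. -/
def Phi (y z : ℝ → ℝ) (U : ℝ → ℝ → ℝ) (τ : ℝ) : ℝ := spaceDeriv y z U τ (z τ)

/-- `U` is a (bounded) classical solution of `U_τ = U_xx` on `0 < τ ≤ T`, `y(τ) < x < z(τ)`,
with initial data `U₀` and Dirichlet data `fm` (lower boundary), `fp` (upper boundary), whose
spatial derivative is continuous up to the two moving boundaries for `τ > 0`.
No compatibility of the data at the two corners `(0, y(0))`, `(0, z(0))` is required. -/
structure IsClassicalSolution (T : ℝ) (y z U₀ fm fp : ℝ → ℝ) (U : ℝ → ℝ → ℝ) : Prop where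
  /-- `U` is continuous on the closed strip except possibly at the two corners -/
  continuousOn : ContinuousOn (fun p : ℝ × ℝ => U p.1 p.2) (lateralStrip T y z ∪ bottom y z)
  /-- `U` is bounded (automatic when `U` is continuous at the corners as well) -/
  bounded : ∃ M : ℝ, ∀ p ∈ lateralStrip T y z, |U p.1 p.2| ≤ M
  /-- `U_x` exists in the strip and on the moving boundaries -/
  differentiableWithinAt : ∀ p ∈ lateralStrip T y z,
    DifferentiableWithinAt ℝ (U p.1) (Icc (y p.1) (z p.1)) p.2
  /-- `U_x` is continuous up to the moving boundaries -/
  continuousOn_spaceDeriv :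
    ContinuousOn (fun p : ℝ × ℝ => spaceDeriv y z U p.1 p.2) (lateralStrip T y z)
  /-- `U_xx` exists in the interior -/
  differentiableAt_deriv : ∀ p ∈ interiorStrip T y z, DifferentiableAt ℝ (deriv (U p.1)) p.2
  /-- `U_xx` is continuous in the interior -/
  continuousOn_deriv_deriv :
    ContinuousOn (fun p : ℝ × ℝ => deriv (deriv (U p.1)) p.2) (interiorStrip T y z)
  /-- the heat equation (at the final time `T` the time derivative is the left one) -/
  heat : ∀ p ∈ interiorStrip T y z,
    HasDerivWithinAt (fun t => U t p.2) (deriv (deriv (U p.1)) p.2) (Icc 0 T) p.1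
  /-- the initial condition -/
  initial : ∀ x ∈ Ioo (y 0) (z 0), U 0 x = U₀ x
  /-- the boundary condition at `x = y(τ)` -/
  lower : ∀ τ ∈ Ioc 0 T, U τ (y τ) = fm τ
  /-- the boundary condition at `x = z(τ)` -/
  upper : ∀ τ ∈ Ioc 0 T, U τ (z τ) = fp τ

/-- The width `l(τ) = z(τ) - y(τ)`. -/
def width (y z : ℝ → ℝ) (τ : ℝ) : ℝ := z τ - y τ

/-- The rebate term `β(τ, s, n)`. -/
def beta (y z fm fp : ℝ → ℝ) (τ s : ℝ) (n : ℕ) : ℝ :=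
  fm s * (π * n / width y z τ * cos (π * n / width y z τ * (y s - y τ))
      - deriv y s * sin (π * n / width y z τ * (y s - y τ)))
  - fp s * (π * n / width y z τ * cos (π * n / width y z τ * (z s - y τ))
      - deriv z s * sin (π * n / width y z τ * (z s - y τ)))

/-- The boundary term `F(τ, x)`, for `y(τ) ≤ x ≤ z(τ)`. -/
def boundaryTerm (y z fm fp : ℝ → ℝ) (τ x : ℝ) : ℝ :=
  open Classical in if x = y τ then fm τ else if x = z τ then fp τ else 0

/-- The integrand in time of the `n`-th coefficient of the generalized sine series. -/
def sineIntegrand (y z fm fp Ψ Φ : ℝ → ℝ) (τ : ℝ) (n : ℕ) (s : ℝ) : ℝ :=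
  exp (-(π ^ 2 * (n : ℝ) ^ 2 / width y z τ ^ 2 * (τ - s))) *
    (Φ s * sin (π * n / width y z τ * (z s - y τ))
      + Ψ s * sin (π * n / width y z τ * (y s - y τ))
      + beta y z fm fp τ s n)

/-- The expression in braces in the `n`-th term of the generalized sine series. -/
def sineCoeff (y z U₀ fm fp Ψ Φ : ℝ → ℝ) (τ : ℝ) (n : ℕ) : ℝ :=
  exp (-(π ^ 2 * (n : ℝ) ^ 2 / width y z τ ^ 2 * τ)) *
      (∫ ξ in (y 0)..(z 0), U₀ ξ * sin (π * n / width y z τ * (ξ - y τ)))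
    + ∫ s in (0 : ℝ)..τ, sineIntegrand y z fm fp Ψ Φ τ n s

/-- The Jacobi theta function `θ₃(v, ω) = 1 + 2 ∑_{n ≥ 1} ω^(n²) cos(2 n v)`, for `|ω| < 1`. -/
def theta3 (v ω : ℝ) : ℝ :=
  1 + 2 * ∑' n : ℕ, ω ^ ((n + 1) ^ 2) * cos (2 * ((n : ℝ) + 1) * v)

/-- The derivative `θ₃'(v, ω)` with respect to the first argument. -/
def theta3' (v ω : ℝ) : ℝ := deriv (fun w => theta3 w ω) v

/-- `exp (- π² (τ - s) / l(τ)²)`; this is `ω₂`, and it is `ω₁` for `s = 0`. -/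
def nome (y z : ℝ → ℝ) (τ s : ℝ) : ℝ := exp (-(π ^ 2 * (τ - s) / width y z τ ^ 2))

/-- `φ₋(x, ξ) = π (x - ξ) / (2 l(τ))`. -/
def phiMinus (y z : ℝ → ℝ) (τ x ξ : ℝ) : ℝ := π * (x - ξ) / (2 * width y z τ)

/-- `φ₊(x, ξ) = π (x + ξ - 2 y(τ)) / (2 l(τ))`. -/
def phiPlus (y z : ℝ → ℝ) (τ x ξ : ℝ) : ℝ := π * (x + ξ - 2 * y τ) / (2 * width y z τ)

/-- `θ₃(φ₋(x, ξ), ω) - θ₃(φ₊(x, ξ), ω)` with `ω = exp (- π² (τ - s) / l(τ)²)`. -/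
def thetaDiff (y z : ℝ → ℝ) (τ s x ξ : ℝ) : ℝ :=
  theta3 (phiMinus y z τ x ξ) (nome y z τ s) - theta3 (phiPlus y z τ x ξ) (nome y z τ s)

/-- `θ₃'(φ₋(x, ξ), ω) + θ₃'(φ₊(x, ξ), ω)` with `ω = exp (- π² (τ - s) / l(τ)²)`. -/
def thetaDerivSum (y z : ℝ → ℝ) (τ s x ξ : ℝ) : ℝ :=
  theta3' (phiMinus y z τ x ξ) (nome y z τ s) + theta3' (phiPlus y z τ x ξ) (nome y z τ s)

/-- The integrand in time of the theta function form. -/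
def thetaIntegrand (y z fm fp Ψ Φ : ℝ → ℝ) (τ x s : ℝ) : ℝ :=
  (Ψ s - fm s * deriv y s) * thetaDiff y z τ s x (y s)
    + (Φ s + fp s * deriv z s) * thetaDiff y z τ s x (z s)
    + π / (2 * width y z τ) *
        (fp s * thetaDerivSum y z τ s x (z s) - fm s * thetaDerivSum y z τ s x (y s))

end

end MovingStrip

/-! Fix `τ` and write `l = l(τ)`. The braces in the sine series are exactly the sine coefficients of
`U(τ, ·)` on `[y(τ), z(τ)]`. To see this, test the heat equation against the heat mode `w(s, x) =
exp(-c²(τ - s)) sin(c(x - y(τ)))` with `c = πn/l`, which solves the backward equation `w_s + w_xx =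
0`. In the moving coordinate `x = y(s) + r(z(s) - y(s))` the strip becomes a rectangle, and Green's
identity there expresses `∫ U(τ, ·) w(τ, ·)` by the initial integral and the boundary flux. Since
`w` does not vanish on the boundary at earlier times, both the gradients and the Dirichlet data
enter this flux (`IsClassicalSolution.green`). The corners do no harm, because `U` is bounded and
the flux is integrable.

At an interior point `U(τ, ·)` is differentiable, so its sine series converges to it there, by the
Dirichlet kernel and the Riemann–Lebesgue lemma (`tendsto_sine_series`). At an end point every sine
vanishes and `F` supplies the value.

The theta form is the same series summed under the integral signs. The exchange is delicate: the
nome tends to `1` as `s → τ`, and the Dirichlet data contribute terms that grow like `n`. Abel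
summation resolves it. Inserting the weight `r^(n²)` amounts to replacing the nome `ω` by `rω`, and
for `r < 1` the exchange is dominated (`hasSum_integral_thetaMode`). As `r → 1`, the series side
converges by Abel's theorem (`tendsto_tsum_pow_sq_mul`). The integral side converges by dominated
convergence (`tendsto_integral_thetaPair`), because `θ₃` and `θ₃'` stay bounded up to nome `1` when
the argument stays away from `πℤ`, a consequence of Jacobi's transformation (`exists_bound_kernel`).
For `x` strictly between the boundaries the arguments do stay away from `πℤ` as `s → τ`. -/

namespace MovingStrip

/-! ### Pointwise convergence of sine series -/

/-- The Riemann–Lebesgue lemma for a sine kernel with half-integer frequencies. -/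
lemma tendsto_integral_mul_sin (k : ℝ → ℝ) (a b x : ℝ) (hk : IntervalIntegrable k volume a b)
    (hab : a ≤ b) :
    Tendsto (fun N : ℕ => ∫ ξ in a..b, k ξ * sin (((N : ℝ) + 1 / 2) * (x - ξ))) atTop (𝓝 0) := by
  have hk' : IntegrableOn k (Ioc a b) := (intervalIntegrable_iff_integrableOn_Ioc_of_le hab).1 hk
  let f : ℝ → ℂ := (Ioc a b).indicator fun ξ => (k ξ : ℂ)
  have hRL := Real.tendsto_integral_exp_smul_cocompact f
  have hN : Tendsto (fun N : ℕ => ((N : ℝ) + 1 / 2) / (2 * π)) atTop (cocompact ℝ) := by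
    refine Tendsto.mono_right ?_ atTop_le_cocompact
    refine Tendsto.atTop_div_const (by positivity) ?_
    exact tendsto_atTop_add_const_right _ _ tendsto_natCast_atTop_atTop
  have h := (hRL.comp hN).norm
  rw [norm_zero] at h
  refine squeeze_zero_norm (fun N => ?_) h
  set M : ℝ := (N : ℝ) + 1 / 2 with hM
  have hfI : Integrable (fun v => Real.fourierChar (-(v * (M / (2 * π)))) • f v) := by
    have : Integrable f := (integrable_indicator_iff measurableSet_Ioc).2 hk'.ofReal
    refine this.bdd_mul (c := 1) ?_ ?_ |>.congr (f := fun v => (Real.fourierChar (-(v * (M / (2 * π)))) : ℂ) * f v) ?_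
    · exact (Continuous.aestronglyMeasurable (by fun_prop))
    · exact Eventually.of_forall fun v => (Circle.norm_coe _).le
    · exact Eventually.of_forall fun v => by simp [Circle.smul_def]
  -- The factor `e^(iMx)` shifts the phase of the Fourier integral at frequency `M/(2π)` and has
  -- modulus one, so the sine integral is bounded by the norm of that Fourier integral.
  have key : ∫ ξ in a..b, k ξ * sin (M * (x - ξ)) =
      (Complex.exp ((M * x : ℝ) * Complex.I) *
        ∫ v, Real.fourierChar (-(v * (M / (2 * π)))) • f v).im := by
    rw [← integral_const_mul, ← Complex.imCLM_apply, ← ContinuousLinearMap.integral_comp_comm _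
      (hfI.const_mul _), intervalIntegral.integral_of_le hab, ← integral_indicator measurableSet_Ioc]
    congr 1
    ext v
    by_cases hv : v ∈ Ioc a b
    · simp only [f, indicator_of_mem hv, Complex.imCLM_apply, Circle.smul_def, smul_eq_mul,
        Real.fourierChar_apply]
      rw [← mul_assoc, ← Complex.exp_add, Complex.im_mul_ofReal, ← add_mul, ← Complex.ofReal_add,
        Complex.exp_ofReal_mul_I_im, mul_comm]
      congr 2
      field_simp
      ring
    · simp [f, indicator_of_notMem hv]
  rw [key, Real.norm_eq_abs]
  refine (Complex.abs_im_le_norm _).trans ?_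
  rw [norm_mul, Complex.norm_exp_ofReal_mul_I, one_mul]
  rfl

/-- The sum telescopes: `2 cos(nu) sin(u/2) = sin((n + 1/2)u) - sin((n - 1/2)u)`. The product form
remains valid where `sin(u/2) = 0`. -/
lemma dirichlet_kernel (u : ℝ) (N : ℕ) :
    (1 + 2 * ∑ n ∈ Finset.Icc 1 N, cos (n * u)) * sin (u / 2) = sin (((N : ℝ) + 1 / 2) * u) := by
  induction N with
  | zero => simp; ring_nf
  | succ N ih =>
    rw [Finset.sum_Icc_succ_top (by omega), mul_add, ← add_assoc, add_mul, ih]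
    have h1 : (((N + 1 : ℕ) : ℝ) + 1 / 2) * u = (N + 1 : ℝ) * u + u / 2 := by push_cast; ring
    have h2 : ((N : ℝ) + 1 / 2) * u = (N + 1 : ℝ) * u - u / 2 := by ring
    rw [h1, h2, sin_add, sin_sub]
    push_cast
    ring

/-- Removes the singularity of the Dirichlet kernel at `ξ = x`. Both `h` and `sin((x - ξ)/2)` vanish
there, so `k` can be the quotient of their slopes from `x`; the slope of the sine has no zero
because `(x - ξ)/2` lies in `(-π/2, π/2)`. -/
lemma continuousOn_div_sin (h : ℝ → ℝ) (x : ℝ) (hx : x ∈ Ioo 0 π) (hc : ContinuousOn h (Icc 0 π))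
    (hd : DifferentiableAt ℝ h x) (h0 : h x = 0) :
    ∃ k : ℝ → ℝ, ContinuousOn k (Icc 0 π) ∧
      ∀ ξ ∈ Icc 0 π, h ξ = k ξ * sin ((x - ξ) / 2) := by
  have hn : Icc 0 π ∈ 𝓝 x := Icc_mem_nhds hx.1 hx.2
  let q : ℝ → ℝ := fun ξ => sin ((x - ξ) / 2)
  have hq : HasDerivAt q (-(1 / 2)) x := by
    have : HasDerivAt (fun ξ : ℝ => (x - ξ) / 2) (-1 / 2) x :=
      ((hasDerivAt_id x).const_sub x).div_const 2
    convert this.sin using 1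
    simp; norm_num
  have hqx : q x = 0 := by simp [q]
  have hne : ∀ ξ ∈ Icc 0 π, dslope q x ξ ≠ 0 := by
    intro ξ hξ
    by_cases he : ξ = x
    · subst he
      rw [dslope_same, hq.deriv]; norm_num
    · rw [dslope_of_ne _ he, slope_def_field, hqx, sub_zero]
      refine div_ne_zero ?_ (sub_ne_zero.2 he)
      intro h0
      have := (sin_eq_zero_iff_of_lt_of_lt (by linarith [hx.1, hξ.2, pi_pos])
        (by linarith [hx.2, hξ.1, pi_pos])).1 h0
      exact he (by linarith)
  refine ⟨fun ξ => dslope h x ξ / dslope q x ξ, ?_, ?_⟩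
  · refine ContinuousOn.div ((continuousOn_dslope hn).2 ⟨hc, hd⟩)
      ((continuousOn_dslope hn).2 ⟨?_, hq.differentiableAt⟩) hne
    exact Continuous.continuousOn (by fun_prop)
  · intro ξ hξ
    have e1 := sub_smul_dslope h x ξ
    have e2 := sub_smul_dslope q x ξ
    rw [h0, sub_zero, smul_eq_mul] at e1
    rw [hqx, sub_zero, smul_eq_mul] at e2
    have hn := hne ξ hξ
    change h ξ = _ * q ξ
    rw [← e1, ← e2]
    field_simp

/-- By `2 sin(nx) sin(nξ) = cos(n(x - ξ)) - cos(n(x + ξ))` the partial sum is a difference of two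
Dirichlet integrals, at `x` and at the reflected point `-x`. The first has a continuous density
since `h x = 0`, the second because `(x + ξ)/2` stays in `(0, π)`; Riemann–Lebesgue then applies to
each. -/
lemma tendsto_sine_series_of_eq_zero (h : ℝ → ℝ) (x : ℝ) (hx : x ∈ Ioo 0 π)
    (hc : ContinuousOn h (Icc 0 π)) (hd : DifferentiableAt ℝ h x) (h0 : h x = 0) :
    Tendsto (fun N : ℕ => 2 / π * ∑ n ∈ Finset.Icc 1 N,
      sin (n * x) * ∫ ξ in (0 : ℝ)..π, h ξ * sin (n * ξ)) atTop (𝓝 0) := by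
  obtain ⟨k, hk, hkh⟩ := continuousOn_div_sin h x hx hc hd h0
  let k₂ : ℝ → ℝ := fun ξ => h ξ / sin ((-x - ξ) / 2)
  have hne : ∀ ξ ∈ Icc 0 π, sin ((-x - ξ) / 2) ≠ 0 := by
    intro ξ hξ
    refine (sin_neg_of_neg_of_neg_pi_lt ?_ ?_).ne
    · linarith [hx.1, hξ.1]
    · linarith [hx.2, hξ.2]
  have hk₂ : ContinuousOn k₂ (Icc 0 π) :=
    hc.div (Continuous.continuousOn (by fun_prop)) hne
  have hpi := pi_pos.le
  have hI : ∀ f : ℝ → ℝ, ContinuousOn f (Icc 0 π) → IntervalIntegrable f volume 0 π :=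
    fun f hf => ContinuousOn.intervalIntegrable (by rwa [uIcc_of_le hpi])
  have t1 := tendsto_integral_mul_sin k 0 π x (hI _ hk) hpi
  have t2 := tendsto_integral_mul_sin k₂ 0 π (-x) (hI _ hk₂) hpi
  have t := (t1.sub t2).const_mul (1 / (2 * π))
  rw [sub_zero, mul_zero] at t
  refine t.congr fun N => ?_
  rw [← intervalIntegral.integral_sub]
  rotate_left
  · exact hI _ (hk.mul (Continuous.continuousOn (by fun_prop)))
  · exact hI _ (hk₂.mul (Continuous.continuousOn (by fun_prop)))
  have e : ∀ ξ ∈ uIcc 0 π, k ξ * sin ((N + 1 / 2) * (x - ξ)) - k₂ ξ * sin ((N + 1 / 2) * (-x - ξ))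
      = ∑ n ∈ Finset.Icc 1 N, 4 * sin (n * x) * (h ξ * sin (n * ξ)) := by
    intro ξ hξ
    rw [uIcc_of_le hpi] at hξ
    rw [← dirichlet_kernel, ← dirichlet_kernel]
    have e1 := hkh ξ hξ
    have e2 : h ξ = k₂ ξ * sin ((-x - ξ) / 2) := by
      simp only [k₂]; field_simp [hne ξ hξ]
    have : k ξ * ((1 + 2 * ∑ n ∈ Finset.Icc 1 N, cos (n * (x - ξ))) * sin ((x - ξ) / 2))
        - k₂ ξ * ((1 + 2 * ∑ n ∈ Finset.Icc 1 N, cos (n * (-x - ξ))) * sin ((-x - ξ) / 2))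
        = 2 * (h ξ * (∑ n ∈ Finset.Icc 1 N, cos (n * (x - ξ))
          - ∑ n ∈ Finset.Icc 1 N, cos (n * (-x - ξ)))) := by
      calc _ = (k ξ * sin ((x - ξ) / 2)) * (1 + 2 * ∑ n ∈ Finset.Icc 1 N, cos (n * (x - ξ)))
          - (k₂ ξ * sin ((-x - ξ) / 2)) * (1 + 2 * ∑ n ∈ Finset.Icc 1 N, cos (n * (-x - ξ))) := by
            ring
        _ = _ := by rw [← e1, ← e2]; ring
    rw [this, ← Finset.sum_sub_distrib, Finset.mul_sum, Finset.mul_sum]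
    refine Finset.sum_congr rfl fun n _ => ?_
    rw [show (n : ℝ) * (x - ξ) = n * x - n * ξ by ring,
      show (n : ℝ) * (-x - ξ) = -(n * x + n * ξ) by ring, cos_neg, cos_sub, cos_add]
    ring
  rw [intervalIntegral.integral_congr e, intervalIntegral.integral_finsetSum]
  · simp_rw [intervalIntegral.integral_const_mul]
    rw [Finset.mul_sum, Finset.mul_sum]
    refine Finset.sum_congr rfl fun n _ => ?_
    field_simp
    ring
  · intro n _
    exact (hI _ (hc.mul (Continuous.continuousOn (by fun_prop)))).const_mul _

lemma integral_sin_mul_sin_nat (n : ℕ) (hn : 1 ≤ n) :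
    ∫ ξ in (0 : ℝ)..π, sin ξ * sin (n * ξ) = if n = 1 then π / 2 else 0 := by
  split_ifs with h
  · subst h
    have : ∀ ξ : ℝ, sin ξ * sin ((1 : ℕ) * ξ) = sin ξ ^ 2 := fun ξ => by simp [sq]
    simp_rw [this, integral_sin_sq]
    simp
  · have hn2 : (2 : ℝ) ≤ n := by exact_mod_cast (by omega : 2 ≤ n)
    have e : ∀ ξ : ℝ, sin ξ * sin (n * ξ) =
        1 / 2 * cos ((n - 1) * ξ) - 1 / 2 * cos ((n + 1) * ξ) := fun ξ => by
      rw [sub_mul, add_mul, one_mul, cos_sub, cos_add]; ring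
    have c : ∀ m : ℤ, (m : ℝ) ≠ 0 → ∫ ξ in (0 : ℝ)..π, cos (m * ξ) = 0 := fun m hm => by
      rw [intervalIntegral.integral_comp_mul_left (fun u => cos u) hm, integral_cos]
      simp
    have c1 := c (n - 1) (by push_cast; linarith)
    have c2 := c (n + 1) (by push_cast; linarith)
    push_cast at c1 c2
    simp_rw [e]
    rw [intervalIntegral.integral_sub, intervalIntegral.integral_const_mul,
      intervalIntegral.integral_const_mul, c1, c2]
    · simp
    all_goals exact Continuous.intervalIntegrable (by fun_prop) _ _

/-- Pointwise convergence of the Fourier sine series on `[0, π]` at a point of differentiability. -/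
lemma tendsto_sine_series_pi (g : ℝ → ℝ) (x : ℝ) (hx : x ∈ Ioo 0 π)
    (hc : ContinuousOn g (Icc 0 π)) (hd : DifferentiableAt ℝ g x) :
    Tendsto (fun N : ℕ => 2 / π * ∑ n ∈ Finset.Icc 1 N,
      sin (n * x) * ∫ ξ in (0 : ℝ)..π, g ξ * sin (n * ξ)) atTop (𝓝 (g x)) := by
  have hs : sin x ≠ 0 := (sin_pos_of_mem_Ioo hx).ne'
  -- To reduce to a function vanishing at `x`, subtract a multiple of `sin` rather than a constant:
  -- its sine series is the single term `n = 1`, present in the partial sum once `N ≥ 1`.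
  set c := g x / sin x with hcdef
  have hcx : c * sin x = g x := by rw [hcdef]; field_simp
  have t := tendsto_sine_series_of_eq_zero (fun ξ => g ξ - c * sin ξ) x hx
    (hc.sub (Continuous.continuousOn (by fun_prop)))
    (hd.sub (by fun_prop)) (by simp [hcx])
  have t' := t.add_const (g x)
  rw [zero_add] at t'
  refine t'.congr' ?_
  filter_upwards [eventually_ge_atTop 1] with N hN
  have e : ∀ n ∈ Finset.Icc 1 N, sin (n * x) * ∫ ξ in (0 : ℝ)..π, (g ξ - c * sin ξ) * sin (n * ξ)
      = sin (n * x) * (∫ ξ in (0 : ℝ)..π, g ξ * sin (n * ξ))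
        - if n = 1 then c * sin x * (π / 2) else 0 := by
    intro n hn
    have : ∀ ξ, (g ξ - c * sin ξ) * sin (n * ξ) = g ξ * sin (n * ξ) - c * (sin ξ * sin (n * ξ)) :=
      fun ξ => by ring
    simp_rw [this]
    rw [intervalIntegral.integral_sub, intervalIntegral.integral_const_mul,
      integral_sin_mul_sin_nat n (Finset.mem_Icc.1 hn).1]
    · split_ifs with h
      · subst h; simp; ring
      · simp
    · refine ContinuousOn.intervalIntegrable ?_
      rw [uIcc_of_le pi_pos.le]
      exact hc.mul (Continuous.continuousOn (by fun_prop))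
    · exact Continuous.intervalIntegrable (by fun_prop) _ _
  rw [Finset.sum_congr rfl e, Finset.sum_sub_distrib, Finset.sum_ite_eq' (Finset.Icc 1 N) 1,
    if_pos (Finset.mem_Icc.2 ⟨le_rfl, hN⟩), hcx]
  generalize ∑ n ∈ Finset.Icc 1 N, sin (n * x) * ∫ ξ in (0 : ℝ)..π, g ξ * sin (n * ξ) = S
  field_simp
  ring

/-- Pointwise convergence of the Fourier sine series on `[a, b]` at a point of differentiability. -/
lemma tendsto_sine_series (g : ℝ → ℝ) (a b x : ℝ) (hx : x ∈ Ioo a b)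
    (hc : ContinuousOn g (Icc a b)) (hd : DifferentiableAt ℝ g x) :
    Tendsto (fun N : ℕ => 2 / (b - a) * ∑ n ∈ Finset.Icc 1 N,
      sin (π * n * ((x - a) / (b - a))) * ∫ ξ in a..b, g ξ * sin (π * n / (b - a) * (ξ - a)))
      atTop (𝓝 (g x)) := by
  have hl : 0 < b - a := by linarith [hx.1, hx.2]
  have hpi := pi_pos
  set m := (b - a) / π with hm
  have hm0 : 0 < m := by positivity
  have hmπ : m * π = b - a := by rw [hm]; field_simp
  have hx' : m * ((x - a) / m) + a = x := by field_simp; ring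
  have t := tendsto_sine_series_pi (fun u => g (m * u + a)) ((x - a) / m)
    ⟨by have := hx.1; apply div_pos <;> linarith, by rw [div_lt_iff₀ hm0]; linarith [hx.2]⟩
    (hc.comp (Continuous.continuousOn (by fun_prop)) fun u hu => by
      constructor
      · nlinarith [hu.1]
      · nlinarith [hu.2])
    (DifferentiableAt.comp (g := g) (f := fun u => m * u + a) _ (by rwa [hx'])
      (by fun_prop))
  simp only [hx'] at t
  refine t.congr fun N => ?_
  rw [Finset.mul_sum, Finset.mul_sum]
  refine Finset.sum_congr rfl fun n _ => ?_
  have key := intervalIntegral.integral_comp_mul_add (a := 0) (b := π)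
    (fun ξ => g ξ * sin (π * n / (b - a) * (ξ - a))) hm0.ne' a
  rw [mul_zero, zero_add, hmπ, sub_add_cancel] at key
  have e2 : ∀ u : ℝ, sin (π * n / (b - a) * (m * u + a - a)) = sin (n * u) := fun u => by
    congr 1; rw [hm]; field_simp; ring
  simp only [e2] at key
  rw [key, show (n : ℝ) * ((x - a) / m) = π * n * ((x - a) / (b - a)) by rw [hm]; field_simp,
    smul_eq_mul, show 2 / (b - a) = 2 / π * m⁻¹ by rw [hm]; field_simp]
  ring

/-! ### The divergence identity on a rectangle -/

section Rectangle

variable {t : ℝ} {G H K : ℝ → ℝ → ℝ}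

/-- If `∂ₛ G = ∂ᵣ H`, the increment of `∫ G dr` is the integral of the flux `H` through the
sides; interior subrectangles. -/
lemma integral_sub_eq_of_hasDerivAt
    (hG : ∀ s ∈ Ioo 0 t, ∀ r ∈ Ioo (0 : ℝ) 1, HasDerivAt (fun s => G s r) (K s r) s)
    (hH : ∀ s ∈ Ioo 0 t, ∀ r ∈ Ioo (0 : ℝ) 1, HasDerivAt (H s) (K s r) r)
    (hK : ContinuousOn (fun p : ℝ × ℝ => K p.1 p.2) (Ioo 0 t ×ˢ Ioo 0 1))
    {s₁ s₂ a b : ℝ} (h₁ : 0 < s₁) (h₁₂ : s₁ ≤ s₂) (h₂ : s₂ < t) (ha : 0 < a) (hab : a ≤ b)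
    (hb : b < 1) :
    ∫ r in a..b, (G s₂ r - G s₁ r) = ∫ s in s₁..s₂, (H s b - H s a) := by
  have hsub : Icc s₁ s₂ ⊆ Ioo 0 t := fun s hs => ⟨h₁.trans_le hs.1, hs.2.trans_lt h₂⟩
  have rsub : Icc a b ⊆ Ioo 0 1 := fun r hr => ⟨ha.trans_le hr.1, hr.2.trans_lt hb⟩
  have hK' : ContinuousOn (fun p : ℝ × ℝ => K p.1 p.2) (Icc s₁ s₂ ×ˢ Icc a b) :=
    hK.mono (prod_mono hsub rsub)
  have e1 : ∀ r ∈ uIcc a b, G s₂ r - G s₁ r = ∫ s in s₁..s₂, K s r := by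
    intro r hr
    rw [uIcc_of_le hab] at hr
    refine (intervalIntegral.integral_eq_sub_of_hasDerivAt (f := fun s => G s r) (fun s hs => ?_) ?_).symm
    · rw [uIcc_of_le h₁₂] at hs
      exact hG s (hsub hs) r (rsub hr)
    · refine ContinuousOn.intervalIntegrable ?_
      rw [uIcc_of_le h₁₂]
      exact hK'.comp (f := fun s => (s, r)) (by fun_prop) fun s hs => ⟨hs, hr⟩
  have e2 : ∀ s ∈ uIcc s₁ s₂, H s b - H s a = ∫ r in a..b, K s r := by
    intro s hs
    rw [uIcc_of_le h₁₂] at hs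
    refine (intervalIntegral.integral_eq_sub_of_hasDerivAt (f := H s) (fun r hr => ?_) ?_).symm
    · rw [uIcc_of_le hab] at hr
      exact hH s (hsub hs) r (rsub hr)
    · refine ContinuousOn.intervalIntegrable ?_
      rw [uIcc_of_le hab]
      exact hK'.comp (f := fun r => (s, r)) (by fun_prop) fun r hr => ⟨hs, hr⟩
  rw [intervalIntegral.integral_congr e1, intervalIntegral.integral_congr e2]
  refine (intervalIntegral_intervalIntegral_swap ?_).symm
  rw [uIoc_of_le h₁₂, uIoc_of_le hab]
  exact (hK'.integrableOn_compact (isCompact_Icc.prod isCompact_Icc)).mono_set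
    (prod_mono Ioc_subset_Icc_self Ioc_subset_Icc_self)

/-- The same up to the sides `r = 0` and `r = 1`. -/
lemma integral_sub_eq_of_hasDerivAt_of_continuousOn
    (hG : ∀ s ∈ Ioo 0 t, ∀ r ∈ Ioo (0 : ℝ) 1, HasDerivAt (fun s => G s r) (K s r) s)
    (hH : ∀ s ∈ Ioo 0 t, ∀ r ∈ Ioo (0 : ℝ) 1, HasDerivAt (H s) (K s r) r)
    (hK : ContinuousOn (fun p : ℝ × ℝ => K p.1 p.2) (Ioo 0 t ×ˢ Ioo 0 1))
    (hGc : ContinuousOn (fun p : ℝ × ℝ => G p.1 p.2) (Ioo 0 t ×ˢ Icc 0 1))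
    (hHc : ContinuousOn (fun p : ℝ × ℝ => H p.1 p.2) (Ioo 0 t ×ˢ Icc 0 1))
    {s₁ s₂ : ℝ} (h₁ : 0 < s₁) (h₁₂ : s₁ ≤ s₂) (h₂ : s₂ < t) :
    (∫ r in (0 : ℝ)..1, G s₂ r) - (∫ r in (0 : ℝ)..1, G s₁ r)
      = ∫ s in s₁..s₂, (H s 1 - H s 0) := by
  have hsub : Icc s₁ s₂ ⊆ Ioo 0 t := fun s hs => ⟨h₁.trans_le hs.1, hs.2.trans_lt h₂⟩
  have hGs : ∀ s ∈ Ioo 0 t, ContinuousOn (G s) (Icc 0 1) := fun s hs =>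
    hGc.comp (f := fun r => (s, r)) (by fun_prop) fun r hr => ⟨hs, hr⟩
  have hGI : ∀ s ∈ Ioo 0 t, IntervalIntegrable (G s) volume 0 1 := fun s hs =>
    ContinuousOn.intervalIntegrable (by rw [uIcc_of_le zero_le_one]; exact hGs s hs)
  have hs₁ : s₁ ∈ Ioo 0 t := hsub ⟨le_rfl, h₁₂⟩
  have hs₂ : s₂ ∈ Ioo 0 t := hsub ⟨h₁₂, le_rfl⟩
  rw [← intervalIntegral.integral_sub (hGI _ hs₂) (hGI _ hs₁)]
  have hI := (hGI _ hs₂).sub (hGI _ hs₁)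
  set f : ℝ → ℝ := fun r => G s₂ r - G s₁ r with hf
  have hprim : ContinuousOn (fun b => ∫ r in (0 : ℝ)..b, f r) (Icc 0 1) := by
    have := intervalIntegral.continuousOn_primitive_interval' hI left_mem_uIcc
    rwa [uIcc_of_le zero_le_one] at this
  have hε : Ioo (0 : ℝ) (1 / 2) ∈ 𝓝[>] (0 : ℝ) := Ioo_mem_nhdsGT (by norm_num)
  have t0 : Tendsto (fun ε : ℝ => ε) (𝓝[>] 0) (𝓝[Icc 0 1] 0) :=
    tendsto_nhdsWithin_iff.2 ⟨tendsto_id.mono_left nhdsWithin_le_nhds, by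
      filter_upwards [hε] with ε h using ⟨h.1.le, by linarith [h.2]⟩⟩
  have t1 : Tendsto (fun ε : ℝ => 1 - ε) (𝓝[>] 0) (𝓝[Icc 0 1] 1) :=
    tendsto_nhdsWithin_iff.2 ⟨by
      have : Tendsto (fun ε : ℝ => 1 - ε) (𝓝 0) (𝓝 (1 - 0)) := (by fun_prop : Continuous fun ε : ℝ => 1 - ε).tendsto 0
      rw [sub_zero] at this
      exact this.mono_left nhdsWithin_le_nhds, by
      filter_upwards [hε] with ε h using ⟨by linarith [h.2], by linarith [h.1]⟩⟩
  have L : Tendsto (fun ε : ℝ => ∫ r in ε..(1 - ε), f r) (𝓝[>] 0)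
      (𝓝 (∫ r in (0 : ℝ)..1, f r)) := by
    have a1 := (hprim 1 (by simp)).tendsto.comp t1
    have a0 := (hprim 0 (by simp)).tendsto.comp t0
    have := a1.sub a0
    rw [intervalIntegral.integral_same, sub_zero] at this
    refine this.congr' ?_
    filter_upwards [hε] with ε h
    refine intervalIntegral.integral_interval_sub_left ?_ ?_
    · exact hI.mono_set (uIcc_subset_uIcc left_mem_uIcc
        (by rw [uIcc_of_le zero_le_one]; exact ⟨by linarith [h.2], by linarith [h.1]⟩))
    · exact hI.mono_set (uIcc_subset_uIcc left_mem_uIcc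
        (by rw [uIcc_of_le zero_le_one]; exact ⟨h.1.le, by linarith [h.2]⟩))
  obtain ⟨C, hC⟩ := (isCompact_Icc.prod isCompact_Icc).exists_bound_of_continuousOn
    (hHc.mono (prod_mono hsub (subset_refl (Icc (0 : ℝ) 1))))
  have hHr : ∀ r ∈ Icc (0 : ℝ) 1, ContinuousOn (fun s => H s r) (Icc s₁ s₂) := fun r hr =>
    hHc.comp (f := fun s => (s, r)) (by fun_prop) fun s hs => ⟨hsub hs, hr⟩
  have R : Tendsto (fun ε : ℝ => ∫ s in s₁..s₂, (H s (1 - ε) - H s ε)) (𝓝[>] 0)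
      (𝓝 (∫ s in s₁..s₂, (H s 1 - H s 0))) := by
    refine intervalIntegral.tendsto_integral_filter_of_dominated_convergence (fun _ => C + C)
      ?_ ?_ (by simp) ?_
    · filter_upwards [hε] with ε h
      rw [uIoc_of_le h₁₂]
      refine (ContinuousOn.mono ?_ Ioc_subset_Icc_self).aestronglyMeasurable measurableSet_Ioc
      exact (hHr _ ⟨by linarith [h.2], by linarith [h.1]⟩).sub
        (hHr _ ⟨h.1.le, by linarith [h.2]⟩)
    · filter_upwards [hε] with ε h
      refine Eventually.of_forall fun s hs => ?_
      rw [uIoc_of_le h₁₂] at hs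
      exact (norm_sub_le _ _).trans (add_le_add
        (hC (s, 1 - ε) ⟨Ioc_subset_Icc_self hs, by linarith [h.2], by linarith [h.1]⟩)
        (hC (s, ε) ⟨Ioc_subset_Icc_self hs, h.1.le, by linarith [h.2]⟩))
    · refine Eventually.of_forall fun s hs => ?_
      rw [uIoc_of_le h₁₂] at hs
      have hs' := hsub (Ioc_subset_Icc_self hs)
      have hc : ContinuousOn (H s) (Icc 0 1) :=
        hHc.comp (f := fun r => (s, r)) (by fun_prop) fun r hr => ⟨hs', hr⟩
      exact ((hc 1 (by simp)).tendsto.comp t1).sub ((hc 0 (by simp)).tendsto.comp t0)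
  refine tendsto_nhds_unique L (R.congr' ?_)
  filter_upwards [hε] with ε h
  exact (integral_sub_eq_of_hasDerivAt hG hH hK h₁ h₁₂ h₂ h.1 (by linarith [h.2])
    (by linarith [h.1])).symm

/-- The same on the whole rectangle, for bounded `G` and an integrable flux. -/
lemma integral_sub_eq_of_hasDerivAt_of_tendsto (ht : 0 < t) {G₀ G₁ : ℝ → ℝ} {M : ℝ}
    (hG : ∀ s ∈ Ioo 0 t, ∀ r ∈ Ioo (0 : ℝ) 1, HasDerivAt (fun s => G s r) (K s r) s)
    (hH : ∀ s ∈ Ioo 0 t, ∀ r ∈ Ioo (0 : ℝ) 1, HasDerivAt (H s) (K s r) r)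
    (hK : ContinuousOn (fun p : ℝ × ℝ => K p.1 p.2) (Ioo 0 t ×ˢ Ioo 0 1))
    (hGc : ContinuousOn (fun p : ℝ × ℝ => G p.1 p.2) (Ioo 0 t ×ˢ Icc 0 1))
    (hHc : ContinuousOn (fun p : ℝ × ℝ => H p.1 p.2) (Ioo 0 t ×ˢ Icc 0 1))
    (hM : ∀ s ∈ Ioo 0 t, ∀ r ∈ Ioo (0 : ℝ) 1, |G s r| ≤ M)
    (hG₀ : ∀ r ∈ Ioo (0 : ℝ) 1, Tendsto (fun s => G s r) (𝓝[>] 0) (𝓝 (G₀ r)))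
    (hG₁ : ∀ r ∈ Ioo (0 : ℝ) 1, Tendsto (fun s => G s r) (𝓝[<] t) (𝓝 (G₁ r)))
    (hI : IntervalIntegrable (fun s => H s 1 - H s 0) volume 0 t) :
    (∫ r in (0 : ℝ)..1, G₁ r) - (∫ r in (0 : ℝ)..1, G₀ r)
      = ∫ s in (0 : ℝ)..t, (H s 1 - H s 0) := by
  have lim : ∀ (l : Filter ℝ) [l.IsCountablyGenerated] (g : ℝ → ℝ), (∀ᶠ s in l, s ∈ Ioo 0 t) →
      (∀ r ∈ Ioo (0 : ℝ) 1, Tendsto (fun s => G s r) l (𝓝 (g r))) →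
      Tendsto (fun s => ∫ r in (0 : ℝ)..1, G s r) l (𝓝 (∫ r in (0 : ℝ)..1, g r)) := by
    intro l _ g hl hg
    have hne : ∀ᵐ r : ℝ, r ≠ 1 := by simp [ae_iff]
    refine intervalIntegral.tendsto_integral_filter_of_dominated_convergence (fun _ => M)
      ?_ ?_ (by simp) ?_
    · filter_upwards [hl] with s hs
      rw [uIoc_of_le zero_le_one]
      refine (ContinuousOn.mono ?_ Ioc_subset_Icc_self).aestronglyMeasurable measurableSet_Ioc
      exact hGc.comp (f := fun r => (s, r)) (by fun_prop) fun r hr => ⟨hs, hr⟩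
    · filter_upwards [hl] with s hs
      filter_upwards [hne] with r hr hr'
      rw [uIoc_of_le zero_le_one] at hr'
      exact hM s hs r ⟨hr'.1, lt_of_le_of_ne hr'.2 hr⟩
    · filter_upwards [hne] with r hr hr'
      rw [uIoc_of_le zero_le_one] at hr'
      exact hg r ⟨hr'.1, lt_of_le_of_ne hr'.2 hr⟩
  have l0 := lim (𝓝[>] 0) G₀ (Ioo_mem_nhdsGT ht) hG₀
  have l1 := lim (𝓝[<] t) G₁ (Ioo_mem_nhdsLT ht) hG₁
  have hprim : ContinuousOn (fun b => ∫ s in (0 : ℝ)..b, (H s 1 - H s 0)) (Icc 0 t) := by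
    have := intervalIntegral.continuousOn_primitive_interval' hI left_mem_uIcc
    rwa [uIcc_of_le ht.le] at this
  have p0 : Tendsto (fun b => ∫ s in (0 : ℝ)..b, (H s 1 - H s 0)) (𝓝[>] 0) (𝓝 0) := by
    have := (hprim 0 ⟨le_rfl, ht.le⟩).tendsto
    rw [intervalIntegral.integral_same] at this
    refine this.mono_left ?_
    rw [← nhdsWithin_Ioo_eq_nhdsGT ht]
    exact nhdsWithin_mono _ Ioo_subset_Icc_self
  have p1 : Tendsto (fun b => ∫ s in (0 : ℝ)..b, (H s 1 - H s 0)) (𝓝[<] t)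
      (𝓝 (∫ s in (0 : ℝ)..t, (H s 1 - H s 0))) := by
    refine (hprim t ⟨ht.le, le_rfl⟩).tendsto.mono_left ?_
    rw [← nhdsWithin_Ioo_eq_nhdsLT ht]
    exact nhdsWithin_mono _ Ioo_subset_Icc_self
  -- The interior time `t / 2` is a fixed reference: one limit moves the upper time to `t`, the
  -- other moves the lower time to `0`, and the two identities add up.
  have hmid : t / 2 ∈ Ioo 0 t := ⟨by linarith, by linarith⟩
  have hII : ∀ b ∈ Ioo 0 t, IntervalIntegrable (fun s => H s 1 - H s 0) volume 0 b :=
    fun b hb => hI.mono_set (uIcc_subset_uIcc left_mem_uIcc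
      (by rw [uIcc_of_le ht.le]; exact Ioo_subset_Icc_self hb))
  have key : ∀ s₁ ∈ Ioo 0 t, ∀ s₂ ∈ Ioo 0 t, s₁ ≤ s₂ →
      (∫ r in (0 : ℝ)..1, G s₂ r) - (∫ r in (0 : ℝ)..1, G s₁ r)
        = (∫ s in (0 : ℝ)..s₂, (H s 1 - H s 0)) - ∫ s in (0 : ℝ)..s₁, (H s 1 - H s 0) := by
    intro s₁ h₁ s₂ h₂ h
    rw [intervalIntegral.integral_interval_sub_left (hII _ h₂) (hII _ h₁)]
    exact integral_sub_eq_of_hasDerivAt_of_continuousOn hG hH hK hGc hHc h₁.1 h h₂.2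
  have u1 := tendsto_nhds_unique ((l1.sub_const _).congr' (by
    filter_upwards [Ico_mem_nhdsLT hmid.2] with s hs
    exact key _ hmid s ⟨hmid.1.trans_le hs.1, hs.2⟩ hs.1)) (p1.sub_const _)
  have u0 := tendsto_nhds_unique ((l0.const_sub _).congr' (by
    filter_upwards [Ioc_mem_nhdsGT hmid.1] with s hs
    exact key s ⟨hs.1, hs.2.trans_lt hmid.2⟩ _ hmid hs.2)) (p0.const_sub _)
  linarith

end Rectangle

/-! ### Moving coordinates and heat modes -/

/-- The chain rule along a curve, from continuous partial derivatives. -/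
lemma hasDerivAt_comp_curve {U Ut Ux : ℝ → ℝ → ℝ} {Ω : Set (ℝ × ℝ)} (hΩ : IsOpen Ω)
    (ht : ∀ p ∈ Ω, HasDerivAt (fun s => U s p.2) (Ut p.1 p.2) p.1)
    (hx : ∀ p ∈ Ω, HasDerivAt (U p.1) (Ux p.1 p.2) p.2)
    (ct : ContinuousOn (fun p : ℝ × ℝ => Ut p.1 p.2) Ω)
    (cx : ContinuousOn (fun p : ℝ × ℝ => Ux p.1 p.2) Ω)
    {X : ℝ → ℝ} {X' s : ℝ} (hX : HasDerivAt X X' s) (hs : (s, X s) ∈ Ω) :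
    HasDerivAt (fun s => U s (X s)) (Ut s (X s) + Ux s (X s) * X') s := by
  have hn := hΩ.mem_nhds hs
  have h := hasStrictFDerivAt_uncurry_coprod (𝕜 := ℝ) (u := (s, X s)) (f := U)
    (f₁ := fun a b => ContinuousLinearMap.toSpanSingleton ℝ (Ut a b))
    (f₂ := fun a b => ContinuousLinearMap.toSpanSingleton ℝ (Ux a b))
    (by filter_upwards [hn] with p hp using (ht p hp).hasFDerivAt)
    (by filter_upwards [hn] with p hp using (hx p hp).hasFDerivAt)
    ((ContinuousLinearMap.toSpanSingletonCLE (𝕜 := ℝ) (E := ℝ)).continuous.continuousAt.comp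
      (ct.continuousAt hn))
    ((ContinuousLinearMap.toSpanSingletonCLE (𝕜 := ℝ) (E := ℝ)).continuous.continuousAt.comp
      (cx.continuousAt hn))
  have := h.hasFDerivAt.comp_hasDerivAt s ((hasDerivAt_id s).prodMk hX)
  refine this.congr_deriv ?_
  simp [Function.HasUncurry.uncurry, mul_comm]

/-- The point of relative position `r` in the section `[y(s), z(s)]`. -/
def stripPoint (y z : ℝ → ℝ) (s r : ℝ) : ℝ := y s + r * (z s - y s)

/-- The heat mode `exp (-c² (τ - s)) sin (c (x - x₀))`, a solution of the backward equation. -/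
noncomputable def heatMode (c τ x₀ s x : ℝ) : ℝ := exp (-(c ^ 2 * (τ - s))) * sin (c * (x - x₀))

/-- The space derivative of `heatMode`. -/
noncomputable def heatModeDeriv (c τ x₀ s x : ℝ) : ℝ :=
  exp (-(c ^ 2 * (τ - s))) * (c * cos (c * (x - x₀)))

lemma continuous_heatMode (c τ x₀ : ℝ) :
    Continuous fun p : ℝ × ℝ => heatMode c τ x₀ p.1 p.2 := by
  unfold heatMode; fun_prop

lemma continuous_heatModeDeriv (c τ x₀ : ℝ) :
    Continuous fun p : ℝ × ℝ => heatModeDeriv c τ x₀ p.1 p.2 := by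
  unfold heatModeDeriv; fun_prop

lemma hasDerivAt_heatMode_space (c τ x₀ s x : ℝ) :
    HasDerivAt (heatMode c τ x₀ s) (heatModeDeriv c τ x₀ s x) x := by
  have h : HasDerivAt (fun x => c * (x - x₀)) c x := by
    simpa using ((hasDerivAt_id x).sub_const x₀).const_mul c
  refine (h.sin.const_mul _).congr_deriv ?_
  rw [heatModeDeriv]; ring

lemma hasDerivAt_heatModeDeriv_space (c τ x₀ s x : ℝ) :
    HasDerivAt (heatModeDeriv c τ x₀ s) (-(c ^ 2 * heatMode c τ x₀ s x)) x := by
  have h : HasDerivAt (fun x => c * (x - x₀)) c x := by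
    simpa using ((hasDerivAt_id x).sub_const x₀).const_mul c
  refine ((h.cos.const_mul c).const_mul _).congr_deriv ?_
  rw [heatMode]; ring

lemma hasDerivAt_heatMode_time (c τ x₀ s x : ℝ) :
    HasDerivAt (fun s => heatMode c τ x₀ s x) (c ^ 2 * heatMode c τ x₀ s x) s := by
  have h : HasDerivAt (fun s => -(c ^ 2 * (τ - s))) (c ^ 2) s := by
    exact (((hasDerivAt_id s).const_sub τ).const_mul (c ^ 2)).neg.congr_deriv (by ring)
  refine (h.exp.mul_const _).congr_deriv ?_
  rw [heatMode]; ring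

lemma abs_heatMode_le {c τ x₀ s x : ℝ} (hs : s ≤ τ) : |heatMode c τ x₀ s x| ≤ 1 := by
  rw [heatMode, abs_mul, abs_exp]
  refine mul_le_one₀ (exp_le_one_iff.2 ?_) (abs_nonneg _) (abs_sin_le_one _)
  have := mul_nonneg (sq_nonneg c) (sub_nonneg.2 hs)
  linarith

/-! ### Classical solutions and Green's identity on the moving strip -/

section Solution

variable {T : ℝ} {y z U₀ fm fp : ℝ → ℝ} {U : ℝ → ℝ → ℝ}

lemma isOpen_openStrip (hy : ContinuousOn y (Icc 0 T)) (hz : ContinuousOn z (Icc 0 T)) :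
    IsOpen {p : ℝ × ℝ | p.1 ∈ Ioo 0 T ∧ y p.1 < p.2 ∧ p.2 < z p.1} := by
  have hO : IsOpen {p : ℝ × ℝ | p.1 ∈ Ioo 0 T} := isOpen_Ioo.preimage continuous_fst
  have hm : MapsTo Prod.fst {p : ℝ × ℝ | p.1 ∈ Ioo 0 T} (Icc 0 T) :=
    fun p hp => Ioo_subset_Icc_self hp
  have h1 : ContinuousOn (fun p : ℝ × ℝ => p.2 - y p.1) {p : ℝ × ℝ | p.1 ∈ Ioo 0 T} :=
    continuousOn_snd.sub (hy.comp continuousOn_fst hm)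
  have h2 : ContinuousOn (fun p : ℝ × ℝ => z p.1 - p.2) {p : ℝ × ℝ | p.1 ∈ Ioo 0 T} :=
    (hz.comp continuousOn_fst hm).sub continuousOn_snd
  have := (h1.isOpen_inter_preimage hO isOpen_Ioi (t := Ioi 0)).inter
    (h2.isOpen_inter_preimage hO isOpen_Ioi (t := Ioi 0))
  convert this using 1
  ext p
  simp only [mem_ofPred_eq, mem_inter_iff, mem_preimage, mem_Ioi, sub_pos]
  tauto

lemma spaceDeriv_eq_deriv {s x : ℝ} (hx : x ∈ Ioo (y s) (z s)) :
    spaceDeriv y z U s x = deriv (U s) x :=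
  derivWithin_of_mem_nhds (Icc_mem_nhds hx.1 hx.2)

lemma stripPoint_mem_Ioo {s r : ℝ} (h : y s < z s) (hr : r ∈ Ioo (0 : ℝ) 1) :
    stripPoint y z s r ∈ Ioo (y s) (z s) := by
  unfold stripPoint
  constructor
  · nlinarith [mul_pos hr.1 (sub_pos.2 h)]
  · nlinarith [mul_pos (sub_pos.2 hr.2) (sub_pos.2 h)]

lemma stripPoint_mem_Icc {s r : ℝ} (h : y s < z s) (hr : r ∈ Icc (0 : ℝ) 1) :
    stripPoint y z s r ∈ Icc (y s) (z s) := by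
  unfold stripPoint
  constructor
  · nlinarith [mul_nonneg hr.1 (sub_pos.2 h).le]
  · nlinarith [mul_nonneg (sub_nonneg.2 hr.2) (sub_pos.2 h).le]

lemma continuousOn_stripPoint (hy : ContinuousOn y (Icc 0 T)) (hz : ContinuousOn z (Icc 0 T)) :
    ContinuousOn (fun p : ℝ × ℝ => stripPoint y z p.1 p.2) (Icc 0 T ×ˢ univ) := by
  have hm : MapsTo Prod.fst (Icc 0 T ×ˢ (univ : Set ℝ)) (Icc 0 T) := fun p hp => hp.1
  exact (hy.comp continuousOn_fst hm).add (continuousOn_snd.mul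
    ((hz.comp continuousOn_fst hm).sub (hy.comp continuousOn_fst hm)))

variable (hU : IsClassicalSolution T y z U₀ fm fp U)

include hU

/-- A curve of constant relative position `0 < r < 1` reaches the bottom away from the corners, so
it stays where `U` is known to be continuous. -/
lemma IsClassicalSolution.tendsto_stripPoint (hy : ContinuousOn y (Icc 0 T))
    (hz : ContinuousOn z (Icc 0 T)) (hyz : ∀ s ∈ Icc 0 T, y s < z s) {s₀ r : ℝ}
    (hs₀ : s₀ ∈ Icc 0 T) (hr : r ∈ Ioo (0 : ℝ) 1) :
    Tendsto (fun s => U s (stripPoint y z s r)) (𝓝[Icc 0 T] s₀)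
      (𝓝 (U s₀ (stripPoint y z s₀ r))) := by
  have hm : MapsTo (fun s => (s, stripPoint y z s r)) (Icc 0 T)
      (lateralStrip T y z ∪ bottom y z) := by
    intro s hs
    have h := stripPoint_mem_Ioo (hyz s hs) hr
    rcases hs.1.eq_or_lt with h0 | h0
    · right
      subst h0
      exact ⟨rfl, h.1, h.2⟩
    · left
      exact ⟨h0, hs.2, h.1.le, h.2.le⟩
  have hc : ContinuousOn (fun s => (s, stripPoint y z s r)) (Icc 0 T) :=
    continuousOn_id.prodMk ((continuousOn_stripPoint hy hz).comp (f := fun s => (s, r))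
      (by fun_prop) fun s hs => ⟨hs, trivial⟩)
  exact (hU.continuousOn.comp hc hm s₀ hs₀).tendsto

/-- The bound on `U` is assumed only for positive times; it passes to the initial data along the
curves of constant relative position. -/
lemma IsClassicalSolution.exists_bound_initial (hT : 0 < T) (hy : ContinuousOn y (Icc 0 T))
    (hz : ContinuousOn z (Icc 0 T)) (hyz : ∀ s ∈ Icc 0 T, y s < z s) :
    ∃ M : ℝ, ∀ x ∈ Ioo (y 0) (z 0), |U₀ x| ≤ M := by
  obtain ⟨M, hM⟩ := hU.bounded
  refine ⟨M, fun x hx => ?_⟩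
  have h0 : (0 : ℝ) ∈ Icc 0 T := ⟨le_rfl, hT.le⟩
  have hl := sub_pos.2 (hyz 0 h0)
  have hr : (x - y 0) / (z 0 - y 0) ∈ Ioo (0 : ℝ) 1 :=
    ⟨div_pos (sub_pos.2 hx.1) hl, by rw [div_lt_one hl]; linarith [hx.2]⟩
  have hx' : stripPoint y z 0 ((x - y 0) / (z 0 - y 0)) = x := by
    unfold stripPoint; field_simp; ring
  have ht := (hU.tendsto_stripPoint hy hz hyz h0 hr).mono_left
    (nhdsWithin_mono 0 (Ioc_subset_Icc_self (a := 0) (b := T)))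
  rw [nhdsWithin_Ioc_eq_nhdsGT hT, hx', hU.initial x hx] at ht
  refine le_of_tendsto ht.abs ?_
  filter_upwards [Ioc_mem_nhdsGT hT] with s hs
  have := stripPoint_mem_Ioo (hyz s (Ioc_subset_Icc_self hs)) hr
  exact hM (s, _) ⟨hs.1, hs.2, this.1.le, this.2.le⟩

lemma IsClassicalSolution.intervalIntegrable_initial (hT : 0 < T) (hy : ContinuousOn y (Icc 0 T))
    (hz : ContinuousOn z (Icc 0 T)) (hyz : ∀ s ∈ Icc 0 T, y s < z s) :
    IntervalIntegrable U₀ volume (y 0) (z 0) := by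
  obtain ⟨M, hM⟩ := hU.exists_bound_initial hT hy hz hyz
  have h0 := (hyz 0 ⟨le_rfl, hT.le⟩).le
  rw [intervalIntegrable_iff_integrableOn_Ioo_of_le h0]
  have hc : ContinuousOn U₀ (Ioo (y 0) (z 0)) := by
    have : ContinuousOn (fun x => U 0 x) (Ioo (y 0) (z 0)) :=
      hU.continuousOn.comp (f := fun x => ((0 : ℝ), x)) (by fun_prop)
        fun x hx => Or.inr ⟨rfl, hx.1, hx.2⟩
    exact this.congr fun x hx => (hU.initial x hx).symm
  refine IntegrableOn.of_bound measure_Ioo_lt_top (hc.aestronglyMeasurable measurableSet_Ioo) M ?_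
  exact (ae_restrict_iff' measurableSet_Ioo).2 (Eventually.of_forall hM)

lemma IsClassicalSolution.hasDerivAt_space {s x : ℝ} (hs : s ∈ Ioc 0 T) (hx : x ∈ Ioo (y s) (z s)) :
    HasDerivAt (U s) (spaceDeriv y z U s x) x :=
  (hU.differentiableWithinAt (s, x) ⟨hs.1, hs.2, hx.1.le, hx.2.le⟩).hasDerivWithinAt.hasDerivAt
    (Icc_mem_nhds hx.1 hx.2)

lemma IsClassicalSolution.hasDerivAt_spaceDeriv {s x : ℝ} (hs : s ∈ Ioc 0 T)
    (hx : x ∈ Ioo (y s) (z s)) :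
    HasDerivAt (spaceDeriv y z U s) (deriv (deriv (U s)) x) x := by
  refine (hU.differentiableAt_deriv (s, x) ⟨hs.1, hs.2, hx.1, hx.2⟩).hasDerivAt.congr_of_eventuallyEq
    ?_
  filter_upwards [Ioo_mem_nhds hx.1 hx.2] with u hu using spaceDeriv_eq_deriv hu

lemma IsClassicalSolution.hasDerivAt_time {s x : ℝ} (hs : s ∈ Ioo 0 T) (hx : x ∈ Ioo (y s) (z s)) :
    HasDerivAt (fun t => U t x) (deriv (deriv (U s)) x) s :=
  (hU.heat (s, x) ⟨hs.1, hs.2.le, hx.1, hx.2⟩).hasDerivAt (Icc_mem_nhds hs.1 hs.2)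

lemma IsClassicalSolution.hasDerivAt_curve (hy : ContinuousOn y (Icc 0 T))
    (hz : ContinuousOn z (Icc 0 T)) {X : ℝ → ℝ} {X' s : ℝ} (hs : s ∈ Ioo 0 T)
    (hX : HasDerivAt X X' s) (hXs : X s ∈ Ioo (y s) (z s)) :
    HasDerivAt (fun s => U s (X s))
      (deriv (deriv (U s)) (X s) + spaceDeriv y z U s (X s) * X') s := by
  refine hasDerivAt_comp_curve (Ut := fun s x => deriv (deriv (U s)) x) (isOpen_openStrip hy hz)
    ?_ ?_ ?_ ?_ hX ⟨hs, hXs.1, hXs.2⟩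
  · exact fun p hp => hU.hasDerivAt_time hp.1 hp.2
  · exact fun p hp => hU.hasDerivAt_space (Ioo_subset_Ioc_self hp.1) hp.2
  · exact hU.continuousOn_deriv_deriv.mono fun p hp => ⟨hp.1.1, hp.1.2.le, hp.2.1, hp.2.2⟩
  · exact hU.continuousOn_spaceDeriv.mono fun p hp =>
      ⟨hp.1.1, hp.1.2.le, hp.2.1.le, hp.2.2.le⟩

/-- Green's identity for a heat mode on the moving strip. -/
lemma IsClassicalSolution.green (hy : ContDiffOn ℝ 1 y (Icc 0 T)) (hz : ContDiffOn ℝ 1 z (Icc 0 T))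
    (hyz : ∀ s ∈ Icc 0 T, y s < z s) {τ : ℝ} (hτ : τ ∈ Ioc 0 T) (c : ℝ) {B : ℝ → ℝ}
    (hB : ∀ s ∈ Ioo 0 τ, B s =
      exp (-(c ^ 2 * (τ - s))) *
        (Phi y z U s * sin (c * (z s - y τ)) + Psi y z U s * sin (c * (y s - y τ))
          + (fm s * (c * cos (c * (y s - y τ)) - deriv y s * sin (c * (y s - y τ)))
            - fp s * (c * cos (c * (z s - y τ)) - deriv z s * sin (c * (z s - y τ))))))
    (hBI : IntervalIntegrable B volume 0 τ) :
    (∫ ξ in y τ..z τ, U τ ξ * sin (c * (ξ - y τ)))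
      = exp (-(c ^ 2 * τ)) * (∫ ξ in y 0..z 0, U₀ ξ * sin (c * (ξ - y τ)))
        + ∫ s in (0 : ℝ)..τ, B s := by
  have hyc := hy.continuousOn
  have hzc := hz.continuousOn
  have hT : 0 < T := hτ.1.trans_le hτ.2
  have h0T : (0 : ℝ) ∈ Icc 0 T := ⟨le_rfl, hT.le⟩
  have hτT : τ ∈ Icc 0 T := Ioc_subset_Icc_self hτ
  have hsub : Ioo 0 τ ⊆ Ioo 0 T := Ioo_subset_Ioo_right hτ.2
  have hsub' : Ioo 0 τ ⊆ Icc 0 T := hsub.trans Ioo_subset_Icc_self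
  have hyd : ∀ s ∈ Ioo 0 τ, HasDerivAt y (deriv y s) s := fun s hs =>
    ((hy.differentiableOn one_ne_zero).differentiableAt
      (Icc_mem_nhds (hsub hs).1 (hsub hs).2)).hasDerivAt
  have hzd : ∀ s ∈ Ioo 0 τ, HasDerivAt z (deriv z s) s := fun s hs =>
    ((hz.differentiableOn one_ne_zero).differentiableAt
      (Icc_mem_nhds (hsub hs).1 (hsub hs).2)).hasDerivAt
  have hyd' : ContinuousOn (deriv y) (Ioo 0 τ) :=
    (hy.mono hsub').continuousOn_deriv_of_isOpen isOpen_Ioo le_rfl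
  have hzd' : ContinuousOn (deriv z) (Ioo 0 τ) :=
    (hz.mono hsub').continuousOn_deriv_of_isOpen isOpen_Ioo le_rfl
  let X := stripPoint y z
  let X' : ℝ → ℝ → ℝ := fun s r => deriv y s + r * (deriv z s - deriv y s)
  let w := heatMode c τ (y τ)
  let w' := heatModeDeriv c τ (y τ)
  let Ux := spaceDeriv y z U
  -- `G` is `U w` times the Jacobian of `r ↦ X s r`. In the flux `H`, the first two terms come from
  -- `U_xx w - U w_xx` and the last from transport by the velocity `X'` of the coordinate. `K` is
  -- the common value of `∂ₛ G` and `∂ᵣ H`, in which `U_s = U_xx` and `w_s = c² w = -w_xx` have been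
  -- used.
  let G : ℝ → ℝ → ℝ := fun s r => U s (X s r) * w s (X s r) * (z s - y s)
  let H : ℝ → ℝ → ℝ := fun s r =>
    Ux s (X s r) * w s (X s r) - U s (X s r) * w' s (X s r) + U s (X s r) * w s (X s r) * X' s r
  let K : ℝ → ℝ → ℝ := fun s r =>
    ((deriv (deriv (U s)) (X s r) + Ux s (X s r) * X' s r) * w s (X s r)
      + U s (X s r) * (c ^ 2 * w s (X s r) + w' s (X s r) * X' s r)) * (z s - y s)
      + U s (X s r) * w s (X s r) * (deriv z s - deriv y s)
  have hXm : ∀ s ∈ Ioo 0 τ, ∀ r ∈ Ioo (0 : ℝ) 1, X s r ∈ Ioo (y s) (z s) := fun s hs r hr =>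
    stripPoint_mem_Ioo (hyz s (hsub' hs)) hr
  have hXt : ∀ s ∈ Ioo 0 τ, ∀ r, HasDerivAt (fun s => X s r) (X' s r) s := fun s hs r =>
    (hyd s hs).add (((hzd s hs).sub (hyd s hs)).const_mul r)
  have hXr : ∀ s r, HasDerivAt (X s) (z s - y s) r := fun s r =>
    (((hasDerivAt_id r).mul_const (z s - y s)).const_add (y s)).congr_deriv (one_mul _)
  have hG : ∀ s ∈ Ioo 0 τ, ∀ r ∈ Ioo (0 : ℝ) 1, HasDerivAt (fun s => G s r) (K s r) s := by
    intro s hs r hr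
    have hUc := hU.hasDerivAt_curve hyc hzc (hsub hs) (hXt s hs r) (hXm s hs r hr)
    have hw := hasDerivAt_comp_curve (U := w) (Ut := fun s x => c ^ 2 * w s x) (Ux := w')
      isOpen_univ (fun p _ => hasDerivAt_heatMode_time c τ (y τ) p.1 p.2)
      (fun p _ => hasDerivAt_heatMode_space c τ (y τ) p.1 p.2)
      (continuous_const.mul (continuous_heatMode c τ (y τ))).continuousOn
      (continuous_heatModeDeriv c τ (y τ)).continuousOn (hXt s hs r) trivial
    exact (hUc.mul hw).mul ((hzd s hs).sub (hyd s hs))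
  have hH : ∀ s ∈ Ioo 0 τ, ∀ r ∈ Ioo (0 : ℝ) 1, HasDerivAt (H s) (K s r) r := by
    intro s hs r hr
    have hs' := Ioo_subset_Ioc_self (hsub hs)
    have a1 := (hU.hasDerivAt_space hs' (hXm s hs r hr)).comp r (hXr s r)
    have a2 := (hU.hasDerivAt_spaceDeriv hs' (hXm s hs r hr)).comp r (hXr s r)
    have a3 := (hasDerivAt_heatMode_space c τ (y τ) s (X s r)).comp r (hXr s r)
    have a4 := (hasDerivAt_heatModeDeriv_space c τ (y τ) s (X s r)).comp r (hXr s r)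
    have a5 : HasDerivAt (X' s) (deriv z s - deriv y s) r :=
      (((hasDerivAt_id r).mul_const (deriv z s - deriv y s)).const_add (deriv y s)).congr_deriv
        (one_mul _)
    refine (((a2.mul a3).sub (a1.mul a4)).add ((a1.mul a3).mul a5)).congr_deriv ?_
    simp only [K, Ux, w, w', Function.comp, Pi.mul_apply]
    ring
  have hfst : ∀ {A : Set ℝ} {f : ℝ → ℝ}, ContinuousOn f (Ioo 0 τ) →
      ContinuousOn (fun p : ℝ × ℝ => f p.1) (Ioo 0 τ ×ˢ A) := fun hf =>
    hf.comp continuousOn_fst fun p hp => hp.1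
  have hXc : ContinuousOn (fun p : ℝ × ℝ => (p.1, X p.1 p.2)) (Ioo 0 τ ×ˢ Icc 0 1) :=
    continuousOn_fst.prodMk ((continuousOn_stripPoint hyc hzc).mono
      (prod_mono hsub' (subset_univ _)))
  have hXl : MapsTo (fun p : ℝ × ℝ => (p.1, X p.1 p.2)) (Ioo 0 τ ×ˢ Icc 0 1)
      (lateralStrip T y z) := fun p hp => by
    have := stripPoint_mem_Icc (hyz p.1 (hsub' hp.1)) hp.2
    exact ⟨hp.1.1, (hsub hp.1).2.le, this.1, this.2⟩
  have hXi : MapsTo (fun p : ℝ × ℝ => (p.1, X p.1 p.2)) (Ioo 0 τ ×ˢ Ioo 0 1)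
      (interiorStrip T y z) := fun p hp => by
    have := hXm p.1 hp.1 p.2 hp.2
    exact ⟨hp.1.1, (hsub hp.1).2.le, this.1, this.2⟩
  have cU : ContinuousOn (fun p : ℝ × ℝ => U p.1 (X p.1 p.2)) (Ioo 0 τ ×ˢ Icc 0 1) :=
    (hU.continuousOn.mono subset_union_left).comp hXc hXl
  have cUx : ContinuousOn (fun p : ℝ × ℝ => Ux p.1 (X p.1 p.2)) (Ioo 0 τ ×ˢ Icc 0 1) :=
    hU.continuousOn_spaceDeriv.comp hXc hXl
  have cw : ContinuousOn (fun p : ℝ × ℝ => w p.1 (X p.1 p.2)) (Ioo 0 τ ×ˢ Icc 0 1) :=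
    (continuous_heatMode c τ (y τ)).comp_continuousOn hXc
  have cw' : ContinuousOn (fun p : ℝ × ℝ => w' p.1 (X p.1 p.2)) (Ioo 0 τ ×ˢ Icc 0 1) :=
    (continuous_heatModeDeriv c τ (y τ)).comp_continuousOn hXc
  have cX' : ContinuousOn (fun p : ℝ × ℝ => X' p.1 p.2) (Ioo 0 τ ×ˢ Icc 0 1) :=
    (hfst hyd').add (continuousOn_snd.mul ((hfst hzd').sub (hfst hyd')))
  have cl : ContinuousOn (fun p : ℝ × ℝ => z p.1 - y p.1) (Ioo 0 τ ×ˢ Icc 0 1) :=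
    hfst ((hzc.mono hsub').sub (hyc.mono hsub'))
  have hpm : Ioo 0 τ ×ˢ Ioo (0 : ℝ) 1 ⊆ Ioo 0 τ ×ˢ Icc (0 : ℝ) 1 :=
    prod_mono (subset_refl _) Ioo_subset_Icc_self
  have hK : ContinuousOn (fun p : ℝ × ℝ => K p.1 p.2) (Ioo 0 τ ×ˢ Ioo 0 1) := by
    have cUxx : ContinuousOn (fun p : ℝ × ℝ => deriv (deriv (U p.1)) (X p.1 p.2))
        (Ioo 0 τ ×ˢ Ioo 0 1) := hU.continuousOn_deriv_deriv.comp (hXc.mono hpm) hXi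
    exact (((cUxx.add ((cUx.mul cX').mono hpm)).mul (cw.mono hpm)).add
      ((cU.mul ((continuousOn_const.mul cw).add (cw'.mul cX'))).mono hpm)).mul (cl.mono hpm)
      |>.add (((cU.mul cw).mono hpm).mul (hfst (hzd'.sub hyd')))
  have hGc : ContinuousOn (fun p : ℝ × ℝ => G p.1 p.2) (Ioo 0 τ ×ˢ Icc 0 1) := (cU.mul cw).mul cl
  have hHc : ContinuousOn (fun p : ℝ × ℝ => H p.1 p.2) (Ioo 0 τ ×ˢ Icc 0 1) :=
    ((cUx.mul cw).sub (cU.mul cw')).add ((cU.mul cw).mul cX')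
  obtain ⟨M, hM⟩ := hU.bounded
  obtain ⟨C, hC⟩ := isCompact_Icc.exists_bound_of_continuousOn (hzc.sub hyc)
  have hGb : ∀ s ∈ Ioo 0 τ, ∀ r ∈ Ioo (0 : ℝ) 1, |G s r| ≤ M * 1 * C := by
    intro s hs r hr
    have h1 := hM _ (hXl (x := (s, r)) ⟨hs, Ioo_subset_Icc_self hr⟩)
    have h2 : |w s (X s r)| ≤ 1 := abs_heatMode_le hs.2.le
    have h3 : |z s - y s| ≤ C := hC s (hsub' hs)
    have hM0 : 0 ≤ M := (abs_nonneg _).trans h1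
    simp only [G, abs_mul]
    gcongr
  have hwlim : ∀ s₀ ∈ Icc 0 T, ∀ r ∈ Ioo (0 : ℝ) 1,
      Tendsto (fun s => G s r) (𝓝[Icc 0 T] s₀) (𝓝 (G s₀ r)) := by
    intro s₀ hs₀ r hr
    have b1 := hU.tendsto_stripPoint hyc hzc hyz hs₀ hr
    have b2 : ContinuousOn (fun s => w s (X s r)) (Icc 0 T) :=
      (continuous_heatMode c τ (y τ)).comp_continuousOn
        (continuousOn_id.prodMk ((continuousOn_stripPoint hyc hzc).comp (f := fun s => (s, r))
          (by fun_prop) fun s hs => ⟨hs, trivial⟩))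
    exact (b1.mul (b2 s₀ hs₀).tendsto).mul ((hzc.sub hyc) s₀ hs₀).tendsto
  have hG₀ : ∀ r ∈ Ioo (0 : ℝ) 1, Tendsto (fun s => G s r) (𝓝[>] 0) (𝓝 (G 0 r)) := by
    intro r hr
    refine (hwlim 0 h0T r hr).mono_left ?_
    rw [← nhdsWithin_Ioc_eq_nhdsGT hT]
    exact nhdsWithin_mono _ Ioc_subset_Icc_self
  have hG₁ : ∀ r ∈ Ioo (0 : ℝ) 1, Tendsto (fun s => G s r) (𝓝[<] τ) (𝓝 (G τ r)) := by
    intro r hr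
    refine (hwlim τ hτT r hr).mono_left ?_
    rw [← nhdsWithin_Ioo_eq_nhdsLT hτ.1]
    exact nhdsWithin_mono _ hsub'
  -- At `r = 0, 1` the coordinate velocity is `y'` or `z'` and `U` is the Dirichlet datum, which
  -- turns the flux difference into the gradient and rebate terms.
  have hHB : ∀ s ∈ Ioo 0 τ, H s 1 - H s 0 = B s := by
    intro s hs
    have hs' := Ioo_subset_Ioc_self (hsub hs)
    rw [hB s hs]
    have x1 : X s 1 = z s := by simp [X, stripPoint]
    have x0 : X s 0 = y s := by simp [X, stripPoint]
    simp only [H, x0, x1, X', hU.lower s hs', hU.upper s hs', w, w', heatMode, heatModeDeriv, Phi,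
      Psi, Ux]
    ring
  have hae : ∀ᵐ s : ℝ, s ∈ uIoc 0 τ → H s 1 - H s 0 = B s := by
    have hne : ∀ᵐ s : ℝ, s ≠ τ := by simp [ae_iff]
    filter_upwards [hne] with s hs hs'
    rw [uIoc_of_le hτ.1.le] at hs'
    exact hHB s ⟨hs'.1, lt_of_le_of_ne hs'.2 hs⟩
  have hHI : IntervalIntegrable (fun s => H s 1 - H s 0) volume 0 τ :=
    hBI.congr_ae ((ae_restrict_iff' measurableSet_uIoc).2 (by
      filter_upwards [hae] with s hs hs' using (hs hs').symm))
  have key := integral_sub_eq_of_hasDerivAt_of_tendsto hτ.1 hG hH hK hGc hHc hGb hG₀ hG₁ hHI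
  rw [intervalIntegral.integral_congr_ae hae] at key
  have hsubst : ∀ (s : ℝ) (f : ℝ → ℝ), s ∈ Icc 0 T →
      ∫ r in (0 : ℝ)..1, f (X s r) * (z s - y s) = ∫ ξ in y s..z s, f ξ := by
    intro s f hs
    have hl := (sub_pos.2 (hyz s hs)).ne'
    have := intervalIntegral.integral_comp_add_mul (a := 0) (b := 1) f hl (y s)
    rw [mul_zero, add_zero, mul_one, add_sub_cancel] at this
    simp only [X, stripPoint, intervalIntegral.integral_mul_const]
    simp_rw [mul_comm _ (z s - y s)] at this ⊢
    rw [this, smul_eq_mul]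
    field_simp
  rw [hsubst τ (fun ξ => U τ ξ * w τ ξ) hτT, hsubst 0 (fun ξ => U 0 ξ * w 0 ξ) h0T] at key
  have e1 : ∀ ξ, U τ ξ * w τ ξ = U τ ξ * sin (c * (ξ - y τ)) := fun ξ => by
    simp [w, heatMode]
  have e0 : ∫ ξ in y 0..z 0, U 0 ξ * w 0 ξ
      = exp (-(c ^ 2 * τ)) * ∫ ξ in y 0..z 0, U₀ ξ * sin (c * (ξ - y τ)) := by
    rw [← intervalIntegral.integral_const_mul]
    refine intervalIntegral.integral_congr_ae ?_
    have hne : ∀ᵐ s : ℝ, s ≠ z 0 := by simp [ae_iff]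
    filter_upwards [hne] with s hs hs'
    rw [uIoc_of_le (hyz 0 h0T).le] at hs'
    rw [hU.initial s ⟨hs'.1, lt_of_le_of_ne hs'.2 hs⟩]
    simp only [w, heatMode, sub_zero]
    ring
  simp_rw [e1] at key
  rw [e0] at key
  linarith

end Solution


/-! ### Abel summation along the squares -/

/-- Abel's limit theorem for the weights `r ^ (n + 1)²`. -/
lemma tendsto_tsum_pow_sq_mul {c : ℕ → ℝ} {S : ℝ}
    (h : Tendsto (fun N => ∑ n ∈ Finset.range N, c n) atTop (𝓝 S)) :
    Tendsto (fun r : ℝ => ∑' n, r ^ ((n + 1) ^ 2) * c n) (𝓝[<] 1) (𝓝 S) := by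
  let g : ℕ → ℕ := fun n => (n + 1) ^ 2
  have hg : Function.Injective g := fun a b hab => by
    have := Nat.pow_left_injective two_ne_zero hab
    omega
  -- The coefficients are placed at the exponents `(n + 1)²`, with zeros elsewhere, giving an
  -- ordinary power series. Its partial sum over `m < M` contains the `n` with `(n + 1)² ≤ M - 1`,
  -- hence the square root of `M - 1`; truncated subtraction is harmless at `M = 0` since no square
  -- here is `0`.
  let f : ℕ → ℝ := Function.extend g c 0
  have hf : ∀ n, f (g n) = c n := fun n => hg.extend_apply c 0 n
  have hsum : ∀ M, ∑ m ∈ Finset.range M, f m = ∑ n ∈ Finset.range (Nat.sqrt (M - 1)), c n := by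
    intro M
    have hlt : ∀ n, n < Nat.sqrt (M - 1) ↔ g n < M := fun n => by
      rw [← Nat.succ_le_iff, Nat.le_sqrt']
      have : 0 < (n + 1) ^ 2 := by positivity
      simp only [g, Nat.succ_eq_add_one]
      omega
    rw [← Finset.sum_congr rfl fun n _ => hf n, ← Finset.sum_image (g := g) (hg.injOn)]
    refine (Finset.sum_subset ?_ ?_).symm
    · intro m hm
      obtain ⟨n, hn, rfl⟩ := Finset.mem_image.1 hm
      exact Finset.mem_range.2 ((hlt n).1 (Finset.mem_range.1 hn))
    · intro m hm hm'
      refine Function.extend_apply' _ _ _ ?_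
      rintro ⟨n, rfl⟩
      exact hm' (Finset.mem_image_of_mem _
        (Finset.mem_range.2 ((hlt n).2 (Finset.mem_range.1 hm))))
  have hsq : Tendsto (fun M => Nat.sqrt (M - 1)) atTop atTop := by
    refine tendsto_atTop_atTop.2 fun b => ⟨b ^ 2 + 1, fun M hM => ?_⟩
    rw [Nat.le_sqrt']
    omega
  have := Real.tendsto_tsum_powerSeries_nhdsWithin_lt
    ((h.comp hsq).congr fun M => (hsum M).symm)
  refine this.congr fun r => ?_
  rw [← hg.tsum_eq (f := fun m => f m * r ^ m)]
  · exact tsum_congr fun n => by rw [hf, mul_comm]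
  · intro m hm
    by_contra hne
    have h0 : f m = 0 := Function.extend_apply' _ _ _ fun ⟨n, hn⟩ => hne ⟨n, hn⟩
    exact Function.mem_support.1 hm (by rw [h0, zero_mul])

/-! ### The theta series, its derivative and symmetries -/

lemma summable_theta_majorant {ω : ℝ} (h0 : 0 ≤ ω) (h1 : ω < 1) :
    Summable fun n : ℕ => ((n : ℝ) + 1) * ω ^ ((n + 1) ^ 2) := by
  have h : Summable fun n : ℕ => (n : ℝ) ^ 1 * ω ^ n :=
    summable_pow_mul_geometric_of_norm_lt_one 1 (by rwa [Real.norm_of_nonneg h0])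
  have := (summable_nat_add_iff 1).2 h
  refine Summable.of_nonneg_of_le (fun n => by positivity) (fun n => ?_) this
  push_cast
  rw [pow_one]
  refine mul_le_mul_of_nonneg_left (pow_le_pow_of_le_one h0 h1.le ?_) (by positivity)
  nlinarith

/-- The majorant depends only on `ω₀`, so the M-test is uniform in `v` and in `ω ≤ ω₀`; up to a
factor `2` it also serves for the derivative. -/
lemma abs_theta3_term_le {ω₀ ω : ℝ} (h0 : 0 ≤ ω) (h : ω ≤ ω₀) (n : ℕ) (v : ℝ) :
    ‖ω ^ ((n + 1) ^ 2) * cos (2 * ((n : ℝ) + 1) * v)‖ ≤ ((n : ℝ) + 1) * ω₀ ^ ((n + 1) ^ 2) := by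
  rw [norm_mul, Real.norm_of_nonneg (by positivity), mul_comm]
  have h2 : ω ^ ((n + 1) ^ 2) ≤ ω₀ ^ ((n + 1) ^ 2) := pow_le_pow_left₀ h0 h _
  exact mul_le_mul ((abs_cos_le_one _).trans (by linarith [n.cast_nonneg (α := ℝ)])) h2
    (by positivity) (by positivity)

lemma abs_theta3'_term_le {ω₀ ω : ℝ} (h0 : 0 ≤ ω) (h : ω ≤ ω₀) (n : ℕ) (v : ℝ) :
    ‖ω ^ ((n + 1) ^ 2) * (-(2 * ((n : ℝ) + 1)) * sin (2 * ((n : ℝ) + 1) * v))‖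
      ≤ 2 * (((n : ℝ) + 1) * ω₀ ^ ((n + 1) ^ 2)) := by
  rw [norm_mul, Real.norm_of_nonneg (by positivity), norm_mul, norm_neg,
    Real.norm_of_nonneg (by positivity : (0 : ℝ) ≤ 2 * ((n : ℝ) + 1))]
  have h2 : ω ^ ((n + 1) ^ 2) ≤ ω₀ ^ ((n + 1) ^ 2) := pow_le_pow_left₀ h0 h _
  have h3 := abs_sin_le_one (2 * ((n : ℝ) + 1) * v)
  calc _ ≤ ω₀ ^ ((n + 1) ^ 2) * (2 * ((n : ℝ) + 1) * 1) := by
        refine mul_le_mul h2 (mul_le_mul_of_nonneg_left h3 (by positivity)) (by positivity) ?_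
        exact pow_nonneg (h0.trans h) _
    _ = _ := by ring

lemma summable_theta3 {ω : ℝ} (h0 : 0 ≤ ω) (h1 : ω < 1) (v : ℝ) :
    Summable fun n : ℕ => ω ^ ((n + 1) ^ 2) * cos (2 * ((n : ℝ) + 1) * v) :=
  Summable.of_norm_bounded (summable_theta_majorant h0 h1) fun n => abs_theta3_term_le h0 le_rfl n v

lemma theta3'_eq_tsum {ω : ℝ} (h0 : 0 ≤ ω) (h1 : ω < 1) (v : ℝ) :
    theta3' v ω = 2 * ∑' n : ℕ,
      ω ^ ((n + 1) ^ 2) * (-(2 * ((n : ℝ) + 1)) * sin (2 * ((n : ℝ) + 1) * v)) := by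
  have hd : ∀ (n : ℕ) (v : ℝ), HasDerivAt (fun w => ω ^ ((n + 1) ^ 2) * cos (2 * ((n : ℝ) + 1) * w))
      (ω ^ ((n + 1) ^ 2) * (-(2 * ((n : ℝ) + 1)) * sin (2 * ((n : ℝ) + 1) * v))) v := by
    intro n v
    have h : HasDerivAt (fun w => 2 * ((n : ℝ) + 1) * w) (2 * ((n : ℝ) + 1)) v := by
      simpa using (hasDerivAt_id v).const_mul (2 * ((n : ℝ) + 1))
    exact (h.cos.const_mul _).congr_deriv (by ring)
  have := hasDerivAt_tsum ((summable_theta_majorant h0 h1).mul_left 2) hd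
    (fun n v => abs_theta3'_term_le h0 le_rfl n v) (summable_theta3 h0 h1 0) v
  exact ((this.const_mul 2).const_add 1).deriv

lemma summable_theta3' {ω : ℝ} (h0 : 0 ≤ ω) (h1 : ω < 1) (v : ℝ) :
    Summable fun n : ℕ =>
      ω ^ ((n + 1) ^ 2) * (-(2 * ((n : ℝ) + 1)) * sin (2 * ((n : ℝ) + 1) * v)) :=
  Summable.of_norm_bounded ((summable_theta_majorant h0 h1).mul_left 2)
    fun n => abs_theta3'_term_le h0 le_rfl n v

lemma continuousOn_theta3 (v : ℝ) : ContinuousOn (theta3 v) (Ico 0 1) := by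
  have key : ∀ ω₀ ∈ Ico (0 : ℝ) 1, ContinuousOn (theta3 v) (Icc 0 ω₀) := fun ω₀ h =>
    continuousOn_const.add (continuousOn_const.mul (continuousOn_tsum
      (fun n => by fun_prop) (summable_theta_majorant h.1 h.2)
      fun n ω hω => abs_theta3_term_le hω.1 hω.2 n v))
  intro ω hω
  obtain ⟨ω₀, h1, h2⟩ := exists_between hω.2
  refine ((key ω₀ ⟨hω.1.trans h1.le, h2⟩) ω ⟨hω.1, h1.le⟩).mono_of_mem_nhdsWithin ?_
  filter_upwards [self_mem_nhdsWithin, mem_nhdsWithin_of_mem_nhds (Iio_mem_nhds h1)] with u hu hu'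
  exact ⟨hu.1, le_of_lt hu'⟩

lemma continuousOn_theta3' (v : ℝ) : ContinuousOn (theta3' v) (Ico 0 1) := by
  have key : ∀ ω₀ ∈ Ico (0 : ℝ) 1, ContinuousOn (theta3' v) (Icc 0 ω₀) := fun ω₀ h => by
    refine ContinuousOn.congr ?_ fun ω hω => theta3'_eq_tsum hω.1 (hω.2.trans_lt h.2) v
    exact continuousOn_const.mul (continuousOn_tsum
      (fun n => by fun_prop) ((summable_theta_majorant h.1 h.2).mul_left 2)
      fun n ω hω => abs_theta3'_term_le hω.1 hω.2 n v)
  intro ω hω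
  obtain ⟨ω₀, h1, h2⟩ := exists_between hω.2
  refine ((key ω₀ ⟨hω.1.trans h1.le, h2⟩) ω ⟨hω.1, h1.le⟩).mono_of_mem_nhdsWithin ?_
  filter_upwards [self_mem_nhdsWithin, mem_nhdsWithin_of_mem_nhds (Iio_mem_nhds h1)] with u hu hu'
  exact ⟨hu.1, le_of_lt hu'⟩

lemma theta3_neg (v ω : ℝ) : theta3 (-v) ω = theta3 v ω := by
  simp [theta3]

lemma theta3'_neg (v ω : ℝ) : theta3' (-v) ω = -theta3' v ω := by
  have h : (fun w => theta3 w ω) = fun w => theta3 (-w) ω := by ext w; rw [theta3_neg]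
  unfold theta3'
  conv_lhs => rw [h]
  rw [deriv_comp_neg (fun w => theta3 w ω), neg_neg]

lemma theta3_add_pi (v ω : ℝ) : theta3 (v + π) ω = theta3 v ω := by
  have : ∀ n : ℕ, cos (2 * ((n : ℝ) + 1) * (v + π)) = cos (2 * ((n : ℝ) + 1) * v) := fun n => by
    have := cos_add_nat_mul_two_pi (2 * ((n : ℝ) + 1) * v) (n + 1)
    rw [← this]; push_cast; ring_nf
  simp [theta3, this]

lemma theta3'_add_pi (v ω : ℝ) : theta3' (v + π) ω = theta3' v ω := by
  have h : (fun w => theta3 w ω) = fun w => theta3 (w + π) ω := by ext w; rw [theta3_add_pi]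
  unfold theta3'
  conv_rhs => rw [h]
  exact (deriv_comp_add_const (fun w => theta3 w ω) π v).symm

/-! ### Uniform bounds for `θ₃` and `θ₃'` -/

/-- Uniform bounds for the theta function for nomes away from `1`. -/
lemma exists_bound_theta_of_le {ω₀ : ℝ} (h0 : 0 ≤ ω₀) (h1 : ω₀ < 1) :
    ∃ C, ∀ v, ∀ ω ∈ Icc 0 ω₀, |theta3 v ω| ≤ C ∧ |theta3' v ω| ≤ C := by
  have hs := summable_theta_majorant h0 h1
  set S := ∑' n : ℕ, ((n : ℝ) + 1) * ω₀ ^ ((n + 1) ^ 2) with hS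
  have hS0 : 0 ≤ S := tsum_nonneg fun n => by positivity
  refine ⟨1 + 4 * S, fun v ω hω => ⟨?_, ?_⟩⟩
  · have := tsum_of_norm_bounded hs.hasSum fun n => abs_theta3_term_le hω.1 hω.2 n v
    rw [← hS, Real.norm_eq_abs, abs_le] at this
    rw [theta3, abs_le]
    constructor <;> linarith [this.1, this.2]
  · rw [theta3'_eq_tsum hω.1 (hω.2.trans_lt h1)]
    have := tsum_of_norm_bounded (hs.mul_left 2).hasSum
      fun n => abs_theta3'_term_le hω.1 hω.2 n v
    rw [tsum_mul_left, ← hS, Real.norm_eq_abs, abs_le] at this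
    rw [abs_le]
    constructor <;> linarith [this.1, this.2]

-- With `ω = exp(-πt)` and `v = πa`, the theta function becomes a kernel that satisfies Jacobi's
-- functional equation `t ↦ 1/t`, which governs `ω → 1`.
open HurwitzZeta in
lemma theta3_eq_cosKernel (v : ℝ) {t : ℝ} (ht : 0 < t) :
    theta3 v (exp (-π * t)) = cosKernel ((v / π : ℝ) : UnitAddCircle) t := by
  have h := (hasSum_nat_cosKernel₀ (v / π) ht).tsum_eq
  rw [theta3, ← tsum_mul_left, sub_eq_iff_eq_add'.1 h.symm]
  congr 1
  refine tsum_congr fun n => ?_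
  rw [← exp_nat_mul, show 2 * π * (v / π) * ((n : ℝ) + 1) = 2 * ((n : ℝ) + 1) * v by field_simp]
  push_cast
  ring_nf

open HurwitzZeta in
lemma theta3'_eq_sinKernel (v : ℝ) {t : ℝ} (ht : 0 < t) :
    theta3' v (exp (-π * t)) = -2 * sinKernel ((v / π : ℝ) : UnitAddCircle) t := by
  have h := hasSum_nat_sinKernel (v / π) ht
  have h' := ((hasSum_nat_add_iff' 1).2 h).tsum_eq
  simp only [Finset.sum_range_one, Nat.cast_zero, mul_zero, zero_mul, sub_zero] at h'
  rw [theta3'_eq_tsum (exp_pos _).le (by rw [exp_lt_one_iff]; nlinarith [pi_pos]), ← h',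
    ← tsum_mul_left, ← tsum_mul_left]
  refine tsum_congr fun n => ?_
  rw [← exp_nat_mul]
  push_cast
  rw [show 2 * π * (v / π) * ((n : ℝ) + 1) = 2 * ((n : ℝ) + 1) * v by field_simp]
  ring_nf

/-- For `n ≠ 0` one has `|n + a| ≥ δ|n|`. At `n = 0` the term `1 / n ^ 2` is `0` by convention, so
the indicator supplies the bound. -/
lemma one_div_int_add_sq_le {δ a : ℝ} (h1 : δ ≤ a) (h2 : a ≤ 1 - δ) (h0 : 0 < δ) (n : ℤ) :
    1 / (n + a) ^ 2 ≤ δ⁻¹ ^ 2 * (1 / (n : ℝ) ^ 2 + if n = 0 then 1 else 0) := by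
  split_ifs with hn
  · subst hn
    simp only [Int.cast_zero, zero_add]
    rw [← one_div, div_pow, one_pow]
    norm_num
    exact inv_anti₀ (by positivity) (pow_le_pow_left₀ h0.le h1 2)
  · have key : δ * |(n : ℝ)| ≤ |n + a| := by
      rcases lt_or_gt_of_ne hn with h | h
      · have : (n : ℝ) ≤ -1 := by exact_mod_cast (by omega : n ≤ -1)
        rw [abs_of_neg (by linarith), abs_of_neg (by linarith)]
        nlinarith
      · have : (1 : ℝ) ≤ n := by exact_mod_cast h
        rw [abs_of_pos (by linarith), abs_of_pos (by linarith)]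
        nlinarith
    have hn' : (n : ℝ) ≠ 0 := by exact_mod_cast hn
    have hpos : 0 < δ * |(n : ℝ)| := by positivity
    have := pow_le_pow_left₀ hpos.le key 2
    rw [mul_pow, sq_abs, sq_abs] at this
    rw [add_zero, inv_pow, ← one_div, one_div_mul_one_div]
    exact one_div_le_one_div_of_le (by positivity) this

-- With `X = 1/t ≥ 1`, the functional equation turns the kernels into `X^(1/2) ∑ exp(-π(n + a)²X)`
-- and `X^(3/2) ∑ (n + a) exp(-π(n + a)²X)`. Since `|n + a| ≥ δ`, the Gaussian decay absorbs the
-- powers of `X` and leaves multiples of `1/(n + a)²`.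
open HurwitzZeta in
lemma exists_bound_kernel {δ : ℝ} (hδ : 0 < δ) :
    ∃ C, ∀ a ∈ Icc δ (1 - δ), ∀ t ∈ Ioc (0 : ℝ) 1,
      |cosKernel (a : UnitAddCircle) t| ≤ C ∧ |sinKernel (a : UnitAddCircle) t| ≤ C := by
  have hs : Summable fun n : ℤ => δ⁻¹ ^ 2 * (1 / (n : ℝ) ^ 2 + if n = 0 then (1 : ℝ) else 0) :=
    ((Real.summable_one_div_int_pow.2 one_lt_two).add (hasSum_ite_eq 0 1).summable).mul_left _
  set S := ∑' n : ℤ, δ⁻¹ ^ 2 * (1 / (n : ℝ) ^ 2 + if n = 0 then (1 : ℝ) else 0) with hS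
  have hS0 : 0 ≤ S := tsum_nonneg fun n => by split_ifs <;> positivity
  refine ⟨(1 + 2 * δ⁻¹) * S, fun a ha t ht => ?_⟩
  have hne : ∀ n : ℤ, δ ≤ |(n : ℝ) + a| := fun n => by
    rcases lt_or_ge n 0 with h | h
    · have : (n : ℝ) ≤ -1 := by exact_mod_cast (by omega : n ≤ -1)
      rw [abs_of_neg (by linarith [ha.2])]
      linarith [ha.2]
    · have : (0 : ℝ) ≤ n := by exact_mod_cast h
      rw [abs_of_pos (by linarith [ha.1])]
      linarith [ha.1]
  set X := 1 / t with hX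
  have hX1 : 1 ≤ X := by rw [hX, le_div_iff₀ ht.1]; linarith [ht.2]
  have hX0 : 0 < X := by linarith
  have htX : t = 1 / X := by rw [hX]; field_simp
  clear_value X
  -- For `Y = u²X`, both bounds follow from `π > 1` and `1 + Y + Y²/2 ≤ exp Y`.
  have hexp : ∀ u : ℝ, u ≠ 0 → rexp (-π * u ^ 2 * X) * (u ^ 2 * X) ≤ 1 ∧
      rexp (-π * u ^ 2 * X) * (u ^ 2 * X) ^ 2 ≤ 2 := fun u hu => by
    set Y := u ^ 2 * X with hY
    have hY0 : 0 ≤ Y := by positivity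
    have h1 : rexp (-π * u ^ 2 * X) ≤ rexp (-Y) := exp_le_exp.2 (by
      rw [mul_assoc, ← hY]; nlinarith [pi_gt_three])
    have h2 := quadratic_le_exp_of_nonneg hY0
    have h3 : rexp (-Y) * rexp Y = 1 := by rw [← exp_add]; simp
    have h4 := exp_pos (-Y)
    constructor
    · calc _ ≤ rexp (-Y) * rexp Y := mul_le_mul h1 (by nlinarith) hY0 h4.le
        _ = 1 := h3
    · calc _ ≤ rexp (-Y) * (2 * rexp Y) := mul_le_mul h1 (by nlinarith) (by positivity) h4.le
        _ = 2 := by linarith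
  constructor
  · have e : cosKernel (a : UnitAddCircle) t = X ^ (1 / 2 : ℝ) * evenKernel a X := by
      rw [evenKernel_functional_equation, htX]
      have : X ^ (1 / 2 : ℝ) ≠ 0 := (rpow_pos_of_pos hX0 _).ne'
      field_simp
    have h := (hasSum_int_evenKernel a hX0).mul_left (X ^ (1 / 2 : ℝ))
    rw [← e] at h
    have hb := tsum_of_norm_bounded (f := fun n : ℤ => X ^ (1 / 2 : ℝ) * rexp (-π * (n + a) ^ 2 * X))
      hs.hasSum fun n => by
        refine le_trans ?_ (one_div_int_add_sq_le ha.1 ha.2 hδ n)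
        have hu : (n : ℝ) + a ≠ 0 := fun h0 => by have := hne n; rw [h0, abs_zero] at this; linarith
        rw [Real.norm_of_nonneg (by positivity), le_div_iff₀ (by positivity)]
        have hXX : X ^ (1 / 2 : ℝ) ≤ X := by
          simpa using rpow_le_rpow_of_exponent_le hX1 (by norm_num : (1 / 2 : ℝ) ≤ 1)
        calc _ ≤ X * rexp (-π * (n + a) ^ 2 * X) * (n + a) ^ 2 := by gcongr
          _ = rexp (-π * (n + a) ^ 2 * X) * ((n + a) ^ 2 * X) := by ring
          _ ≤ 1 := (hexp _ hu).1
    rw [h.tsum_eq, ← hS, Real.norm_eq_abs] at hb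
    refine hb.trans ?_
    have : 0 ≤ 2 * δ⁻¹ * S := by positivity
    linarith
  · have e : sinKernel (a : UnitAddCircle) t = X ^ (3 / 2 : ℝ) * oddKernel a X := by
      rw [oddKernel_functional_equation, htX]
      have : X ^ (3 / 2 : ℝ) ≠ 0 := (rpow_pos_of_pos hX0 _).ne'
      field_simp
    have h := (hasSum_int_oddKernel a hX0).mul_left (X ^ (3 / 2 : ℝ))
    rw [← e] at h
    have hb := tsum_of_norm_bounded
      (f := fun n : ℤ => X ^ (3 / 2 : ℝ) * ((n + a) * rexp (-π * (n + a) ^ 2 * X)))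
      (hs.mul_left (2 * δ⁻¹)).hasSum fun n => by
        refine le_trans ?_ (mul_le_mul_of_nonneg_left (one_div_int_add_sq_le ha.1 ha.2 hδ n)
          (by positivity))
        have hu : (n : ℝ) + a ≠ 0 := fun h0 => by have := hne n; rw [h0, abs_zero] at this; linarith
        have hu' : 0 < |(n : ℝ) + a| := abs_pos.2 hu
        rw [norm_mul, norm_mul, Real.norm_of_nonneg (by positivity : 0 ≤ X ^ (3 / 2 : ℝ)),
          Real.norm_of_nonneg (exp_pos _).le, Real.norm_eq_abs, mul_one_div,
          le_div_iff₀ (by positivity), ← div_eq_mul_inv, le_div_iff₀ hδ]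
        have hXX : X ^ (3 / 2 : ℝ) ≤ X ^ 2 := by
          rw [← rpow_natCast X 2]
          exact rpow_le_rpow_of_exponent_le hX1 (by norm_num)
        calc _ ≤ X ^ 2 * (|n + a| * rexp (-π * (n + a) ^ 2 * X)) * (n + a) ^ 2 * |n + a| := by
              gcongr
              exact hne n
          _ = X ^ 2 * (|n + a| ^ 2 * rexp (-π * (n + a) ^ 2 * X)) * (n + a) ^ 2 := by ring
          _ = rexp (-π * (n + a) ^ 2 * X) * ((n + a) ^ 2 * X) ^ 2 := by rw [sq_abs]; ring
          _ ≤ 2 := (hexp _ hu).2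
    rw [h.tsum_eq, tsum_mul_left, ← hS, Real.norm_eq_abs] at hb
    refine hb.trans ?_
    linarith

/-- Uniform bounds for the theta function for arguments away from `π ℤ` and nomes close to `1`. -/
lemma exists_bound_theta_of_abs {δ : ℝ} (hδ : 0 < δ) :
    ∃ C, ∀ v, δ ≤ |v| → |v| ≤ π - δ → ∀ ω ∈ Ico (exp (-π)) 1, |theta3 v ω| ≤ C ∧ |theta3' v ω| ≤ C := by
  obtain ⟨C, hC⟩ := exists_bound_kernel (div_pos hδ pi_pos)
  have hpos : ∀ v, δ ≤ v → v ≤ π - δ → ∀ ω ∈ Ico (exp (-π)) 1,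
      |theta3 v ω| ≤ 2 * C ∧ |theta3' v ω| ≤ 2 * C := by
    intro v h1 h2 ω hω
    have hω0 : 0 < ω := (exp_pos _).trans_le hω.1
    have hlog : log ω < 0 := log_neg hω0 hω.2
    have ht : -log ω / π ∈ Ioc (0 : ℝ) 1 := by
      refine ⟨div_pos (by linarith) pi_pos, ?_⟩
      rw [div_le_one pi_pos]
      have := log_le_log (exp_pos _) hω.1
      rw [log_exp] at this
      linarith
    have hω' : ω = exp (-π * (-log ω / π)) := by
      rw [show -π * (-log ω / π) = log ω by field_simp, exp_log hω0]
    have ha : v / π ∈ Icc (δ / π) (1 - δ / π) := by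
      constructor
      · gcongr
      · rw [show 1 - δ / π = (π - δ) / π by field_simp]
        gcongr
    obtain ⟨c1, c2⟩ := hC _ ha _ ht
    rw [hω', theta3_eq_cosKernel _ ht.1, theta3'_eq_sinKernel _ ht.1, abs_mul, abs_neg, abs_two]
    have := (abs_nonneg _).trans c1
    constructor <;> linarith
  refine ⟨2 * C, fun v h1 h2 ω hω => ?_⟩
  rcases abs_cases v with ⟨h, -⟩ | ⟨h, -⟩
  · rw [h] at h1 h2
    exact hpos v h1 h2 ω hω
  · rw [h] at h1 h2
    have := hpos (-v) h1 h2 ω hω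
    rwa [theta3_neg, theta3'_neg, abs_neg] at this

/-- Uniform bounds for the theta function along a path that ends away from `π ℤ`. -/
lemma exists_bound_theta_path {v : ℝ → ℝ} {τ κ : ℝ} (hκ : 0 < κ)
    (hv : ContinuousWithinAt v (Icc 0 τ) τ) (h0 : v τ ≠ 0) (h1 : |v τ| < π) :
    ∃ C, ∀ s ∈ Ico 0 τ, ∀ ω ∈ Icc 0 (exp (-(κ * (τ - s)))),
      |theta3 (v s) ω| ≤ C ∧ |theta3' (v s) ω| ≤ C := by
  -- Half the distance from `|v τ|` to `0` and to `π`, so that the path keeps distance `δ` from both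
  -- for `s` near `τ`.
  set δ := min (|v τ| / 2) ((π - |v τ|) / 2) with hδ
  have hδ0 : 0 < δ := lt_min (by have := abs_pos.2 h0; positivity) (by linarith)
  have hnear : ∀ᶠ s in 𝓝[Icc 0 τ] τ, δ ≤ |v s| ∧ |v s| ≤ π - δ := by
    have a1 : δ < |v τ| := (min_le_left _ _).trans_lt (by have := abs_pos.2 h0; linarith)
    have a2 : |v τ| < π - δ := by
      have := min_le_right (|v τ| / 2) ((π - |v τ|) / 2)
      rw [← hδ] at this; linarith
    filter_upwards [hv.abs.tendsto.eventually (lt_mem_nhds a1),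
      hv.abs.tendsto.eventually (gt_mem_nhds a2)] with s b1 b2 using ⟨b1.le, b2.le⟩
  obtain ⟨ε, hε, hball⟩ := Metric.mem_nhdsWithin_iff.1 hnear
  obtain ⟨C₁, hC₁⟩ := exists_bound_theta_of_abs hδ0
  -- The cases split on `ω`, not on `s`: a nome above `ω₀` forces `τ - s < ε`, where the path is
  -- controlled, and exceeds `exp(-π)`, where the transformed bound applies.
  set ω₀ := max (exp (-(κ * ε))) (exp (-π)) with hω₀
  have hω₀1 : ω₀ < 1 := max_lt (exp_lt_one_iff.2 (by nlinarith)) (exp_lt_one_iff.2 (by linarith [pi_pos]))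
  obtain ⟨C₂, hC₂⟩ := exists_bound_theta_of_le ((exp_pos _).le.trans (le_max_left _ _)) hω₀1
  refine ⟨max C₁ C₂, fun s hs ω hω => ?_⟩
  rcases le_or_gt ω ω₀ with h | h
  · obtain ⟨b1, b2⟩ := hC₂ (v s) ω ⟨hω.1, h⟩
    exact ⟨b1.trans (le_max_right _ _), b2.trans (le_max_right _ _)⟩
  · have h3 : exp (-(κ * ε)) < exp (-(κ * (τ - s))) :=
      (le_max_left _ _).trans_lt (h.trans_le hω.2)
    rw [exp_lt_exp] at h3
    have h4 : τ - s < ε := by nlinarith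
    have h5 := hball (a := s) ⟨by
      rw [Metric.mem_ball, Real.dist_eq, abs_sub_comm, abs_of_pos (by linarith [hs.2])]
      exact h4, hs.1, hs.2.le⟩
    obtain ⟨b1, b2⟩ := hC₁ (v s) h5.1 h5.2 ω ⟨(le_max_right _ _).trans h.le, hω.2.trans_lt
      (exp_lt_one_iff.2 (by nlinarith [hs.2]))⟩
    exact ⟨b1.trans (le_max_left _ _), b2.trans (le_max_left _ _)⟩

/-! ### Theta pairs and the exchange of sum and integral -/

section

/-- The combination of theta values carried by a source of strength `A` and a dipole of
strength `P`. -/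
noncomputable def thetaPair (A P v₁ v₂ ω : ℝ) : ℝ :=
  A * (theta3 v₁ ω - theta3 v₂ ω) + P * (theta3' v₁ ω + theta3' v₂ ω)

/-- The `(n + 1)`-st Fourier mode of `thetaPair`. -/
noncomputable def thetaMode (A P v₁ v₂ ω : ℝ) (n : ℕ) : ℝ :=
  ω ^ ((n + 1) ^ 2) *
    (2 * A * (cos (2 * ((n : ℝ) + 1) * v₁) - cos (2 * ((n : ℝ) + 1) * v₂))
      - 4 * P * ((n : ℝ) + 1) * (sin (2 * ((n : ℝ) + 1) * v₁) + sin (2 * ((n : ℝ) + 1) * v₂)))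

lemma hasSum_thetaMode (A P v₁ v₂ : ℝ) {ω : ℝ} (h0 : 0 ≤ ω) (h1 : ω < 1) :
    HasSum (thetaMode A P v₁ v₂ ω) (thetaPair A P v₁ v₂ ω) := by
  have a := ((summable_theta3 h0 h1 v₁).hasSum.sub (summable_theta3 h0 h1 v₂).hasSum).mul_left
    (2 * A)
  have b := ((summable_theta3' h0 h1 v₁).hasSum.add (summable_theta3' h0 h1 v₂).hasSum).mul_left
    (2 * P)
  have h := (a.add b).congr_fun (g := thetaMode A P v₁ v₂ ω) fun n => by
    simp only [thetaMode]
    ring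
  refine h.summable.hasSum_iff.2 (h.tsum_eq.trans ?_)
  simp only [thetaPair, theta3'_eq_tsum h0 h1, theta3]
  ring

/-- Abel's weight on the modes is a rescaling of the nome. -/
lemma thetaMode_mul (A P v₁ v₂ ω r : ℝ) (n : ℕ) :
    thetaMode A P v₁ v₂ (r * ω) n = r ^ ((n + 1) ^ 2) * thetaMode A P v₁ v₂ ω n := by
  rw [thetaMode, thetaMode, mul_pow]
  ring

lemma abs_thetaMode_le (A P v₁ v₂ : ℝ) {ω : ℝ} (h0 : 0 ≤ ω) (h1 : ω ≤ 1) (n : ℕ) :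
    ‖thetaMode A P v₁ v₂ ω n‖ ≤ 8 * ((n : ℝ) + 1) * (|A| + |P|) := by
  have hω : ω ^ ((n + 1) ^ 2) ≤ 1 := pow_le_one₀ h0 h1
  have hc : |cos (2 * ((n : ℝ) + 1) * v₁) - cos (2 * ((n : ℝ) + 1) * v₂)| ≤ 2 :=
    (abs_sub _ _).trans
      ((add_le_add (abs_cos_le_one _) (abs_cos_le_one _)).trans one_add_one_eq_two.le)
  have hs : |sin (2 * ((n : ℝ) + 1) * v₁) + sin (2 * ((n : ℝ) + 1) * v₂)| ≤ 2 :=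
    (abs_add_le _ _).trans
      ((add_le_add (abs_sin_le_one _) (abs_sin_le_one _)).trans one_add_one_eq_two.le)
  have hn : (0 : ℝ) ≤ n := n.cast_nonneg
  rw [thetaMode, norm_mul, Real.norm_of_nonneg (pow_nonneg h0 _), Real.norm_eq_abs]
  refine (mul_le_of_le_one_left (abs_nonneg _) hω).trans ((abs_sub _ _).trans ?_)
  rw [abs_mul, abs_mul, abs_mul, abs_mul, abs_mul, abs_two, abs_of_nonneg (by positivity :
    (0 : ℝ) ≤ (n : ℝ) + 1), abs_of_pos (by norm_num : (0 : ℝ) < 4)]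
  calc _ ≤ 2 * |A| * 2 + 4 * |P| * ((n : ℝ) + 1) * 2 := by gcongr
    _ ≤ _ := by nlinarith [abs_nonneg A, abs_nonneg P, mul_nonneg hn (abs_nonneg A)]

section Interchange

variable {μ : Measure ℝ} {A P v₁ v₂ q : ℝ → ℝ}

lemma aestronglyMeasurable_thetaMode (hA : Integrable A μ) (hP : Integrable P μ)
    (hv₁ : AEMeasurable v₁ μ) (hv₂ : AEMeasurable v₂ μ) (hq : AEMeasurable q μ) (n : ℕ) :
    AEStronglyMeasurable (fun s => thetaMode (A s) (P s) (v₁ s) (v₂ s) (q s) n) μ := by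
  have hA' := hA.aestronglyMeasurable.aemeasurable
  have hP' := hP.aestronglyMeasurable.aemeasurable
  refine AEMeasurable.aestronglyMeasurable ?_
  unfold thetaMode
  fun_prop

lemma integrable_thetaMode (hA : Integrable A μ) (hP : Integrable P μ)
    (hv₁ : AEMeasurable v₁ μ) (hv₂ : AEMeasurable v₂ μ) (hq : AEMeasurable q μ)
    (hq01 : ∀ᵐ s ∂μ, q s ∈ Ioo (0 : ℝ) 1) (n : ℕ) :
    Integrable (fun s => thetaMode (A s) (P s) (v₁ s) (v₂ s) (q s) n) μ :=
  ((hA.abs.add hP.abs).const_mul (8 * ((n : ℝ) + 1))).mono'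
    (aestronglyMeasurable_thetaMode hA hP hv₁ hv₂ hq n)
    (hq01.mono fun _ hs => abs_thetaMode_le _ _ _ _ hs.1.le hs.2.le n)

/-- The modes grow at most linearly in `n`, uniformly in the nome, and the factor `r ^ ((n + 1) ^
2)` makes this summable. No condition keeping the arguments away from `πℤ` is needed as long as `r <
1`. -/
lemma hasSum_integral_thetaMode (hA : Integrable A μ) (hP : Integrable P μ)
    (hv₁ : AEMeasurable v₁ μ) (hv₂ : AEMeasurable v₂ μ) (hq : AEMeasurable q μ)
    (hq01 : ∀ᵐ s ∂μ, q s ∈ Ioo (0 : ℝ) 1) {r : ℝ} (hr : r ∈ Ioo (0 : ℝ) 1) :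
    HasSum (fun n : ℕ => r ^ ((n + 1) ^ 2) * ∫ s, thetaMode (A s) (P s) (v₁ s) (v₂ s) (q s) n ∂μ)
      (∫ s, thetaPair (A s) (P s) (v₁ s) (v₂ s) (r * q s) ∂μ) := by
  simp_rw [← integral_const_mul, ← thetaMode_mul]
  have hb : ∀ s, (fun n : ℕ => r ^ ((n + 1) ^ 2) * (8 * ((n : ℝ) + 1) * (|A s| + |P s|)))
      = fun n : ℕ => (8 * (|A s| + |P s|)) * (((n : ℝ) + 1) * r ^ ((n + 1) ^ 2)) := fun s => by
    ext n; ring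
  refine hasSum_integral_of_dominated_convergence
    (fun n s => r ^ ((n + 1) ^ 2) * (8 * ((n : ℝ) + 1) * (|A s| + |P s|))) ?_ ?_ ?_ ?_ ?_
  · exact fun n => aestronglyMeasurable_thetaMode hA hP hv₁ hv₂ (hq.const_mul r) n
  · intro n
    filter_upwards [hq01] with s hs
    rw [thetaMode_mul, norm_mul, Real.norm_of_nonneg (pow_nonneg hr.1.le _)]
    exact mul_le_mul_of_nonneg_left (abs_thetaMode_le _ _ _ _ hs.1.le hs.2.le n)
      (pow_nonneg hr.1.le _)
  · refine Eventually.of_forall fun s => ?_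
    rw [hb]
    exact (summable_theta_majorant hr.1.le hr.2).mul_left _
  · simp_rw [hb, tsum_mul_left]
    exact ((hA.abs.add hP.abs).const_mul 8).mul_const _
  · filter_upwards [hq01] with s hs
    exact hasSum_thetaMode _ _ _ _ (mul_pos hr.1 hs.1).le (by nlinarith [hr.1, hr.2, hs.1, hs.2])

lemma aestronglyMeasurable_thetaPair (hA : Integrable A μ) (hP : Integrable P μ)
    (hv₁ : AEMeasurable v₁ μ) (hv₂ : AEMeasurable v₂ μ) (hq : AEMeasurable q μ)
    (hq01 : ∀ᵐ s ∂μ, q s ∈ Ioo (0 : ℝ) 1) :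
    AEStronglyMeasurable (fun s => thetaPair (A s) (P s) (v₁ s) (v₂ s) (q s)) μ := by
  refine aestronglyMeasurable_of_tendsto_ae atTop
    (f := fun N s => ∑ n ∈ Finset.range N, thetaMode (A s) (P s) (v₁ s) (v₂ s) (q s) n)
    (fun N => ?_) ?_
  · exact Finset.aestronglyMeasurable_fun_sum _ fun n _ =>
      aestronglyMeasurable_thetaMode hA hP hv₁ hv₂ hq n
  · filter_upwards [hq01] with s hs
    exact (hasSum_thetaMode _ _ _ _ hs.1.le hs.2).tendsto_sum_nat

lemma abs_thetaPair_le {A P v₁ v₂ ω C : ℝ} (h₁ : |theta3 v₁ ω| ≤ C ∧ |theta3' v₁ ω| ≤ C)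
    (h₂ : |theta3 v₂ ω| ≤ C ∧ |theta3' v₂ ω| ≤ C) :
    ‖thetaPair A P v₁ v₂ ω‖ ≤ 2 * C * (|A| + |P|) := by
  rw [thetaPair, Real.norm_eq_abs]
  refine (abs_add_le _ _).trans ?_
  rw [abs_mul, abs_mul]
  have a := (abs_sub (theta3 v₁ ω) (theta3 v₂ ω)).trans (add_le_add h₁.1 h₂.1)
  have b := (abs_add_le (theta3' v₁ ω) (theta3' v₂ ω)).trans (add_le_add h₁.2 h₂.2)
  calc _ ≤ |A| * (C + C) + |P| * (C + C) := by gcongr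
    _ = _ := by ring

lemma integrable_thetaPair (hA : Integrable A μ) (hP : Integrable P μ)
    (hv₁ : AEMeasurable v₁ μ) (hv₂ : AEMeasurable v₂ μ) (hq : AEMeasurable q μ)
    (hq01 : ∀ᵐ s ∂μ, q s ∈ Ioo (0 : ℝ) 1) {C : ℝ}
    (hC₁ : ∀ᵐ s ∂μ, ∀ ω ∈ Icc 0 (q s), |theta3 (v₁ s) ω| ≤ C ∧ |theta3' (v₁ s) ω| ≤ C)
    (hC₂ : ∀ᵐ s ∂μ, ∀ ω ∈ Icc 0 (q s), |theta3 (v₂ s) ω| ≤ C ∧ |theta3' (v₂ s) ω| ≤ C) :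
    Integrable (fun s => thetaPair (A s) (P s) (v₁ s) (v₂ s) (q s)) μ := by
  refine ((hA.abs.add hP.abs).const_mul (2 * C)).mono'
    (aestronglyMeasurable_thetaPair hA hP hv₁ hv₂ hq hq01) ?_
  filter_upwards [hq01, hC₁, hC₂] with s hs h1 h2
  exact abs_thetaPair_le (h1 _ ⟨hs.1.le, le_rfl⟩) (h2 _ ⟨hs.1.le, le_rfl⟩)

/-- The bounds are required for all nomes up to `q s` because the regularized integrand lives at `r
* q s`; pointwise convergence is continuity of `θ₃` and `θ₃'` in the nome. -/
lemma tendsto_integral_thetaPair (hA : Integrable A μ) (hP : Integrable P μ)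
    (hv₁ : AEMeasurable v₁ μ) (hv₂ : AEMeasurable v₂ μ) (hq : AEMeasurable q μ)
    (hq01 : ∀ᵐ s ∂μ, q s ∈ Ioo (0 : ℝ) 1) {C : ℝ}
    (hC₁ : ∀ᵐ s ∂μ, ∀ ω ∈ Icc 0 (q s), |theta3 (v₁ s) ω| ≤ C ∧ |theta3' (v₁ s) ω| ≤ C)
    (hC₂ : ∀ᵐ s ∂μ, ∀ ω ∈ Icc 0 (q s), |theta3 (v₂ s) ω| ≤ C ∧ |theta3' (v₂ s) ω| ≤ C) :
    Tendsto (fun r => ∫ s, thetaPair (A s) (P s) (v₁ s) (v₂ s) (r * q s) ∂μ) (𝓝[<] 1)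
      (𝓝 (∫ s, thetaPair (A s) (P s) (v₁ s) (v₂ s) (q s) ∂μ)) := by
  have hr : Ioo (0 : ℝ) 1 ∈ 𝓝[<] (1 : ℝ) := Ioo_mem_nhdsLT one_pos
  have hrq : ∀ {r s : ℝ}, r ∈ Ioo (0 : ℝ) 1 → q s ∈ Ioo (0 : ℝ) 1 →
      0 < r * q s ∧ r * q s < q s := fun h h' => ⟨mul_pos h.1 h'.1, by nlinarith [h.2, h'.1]⟩
  refine tendsto_integral_filter_of_dominated_convergence (fun s => 2 * C * (|A s| + |P s|))
    ?_ ?_ ((hA.abs.add hP.abs).const_mul (2 * C)) ?_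
  · filter_upwards [hr] with r h
    refine aestronglyMeasurable_thetaPair hA hP hv₁ hv₂ (hq.const_mul r) ?_
    filter_upwards [hq01] with s hs
    exact ⟨(hrq h hs).1, (hrq h hs).2.trans hs.2⟩
  · filter_upwards [hr] with r h
    filter_upwards [hq01, hC₁, hC₂] with s hs h1 h2
    have := hrq h hs
    exact abs_thetaPair_le (h1 _ ⟨this.1.le, this.2.le⟩) (h2 _ ⟨this.1.le, this.2.le⟩)
  · filter_upwards [hq01] with s hs
    have ht : Tendsto (fun r : ℝ => r * q s) (𝓝[<] 1) (𝓝[Ico 0 1] (q s)) := by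
      refine tendsto_nhdsWithin_iff.2 ⟨?_, ?_⟩
      · have : Tendsto (fun r : ℝ => r * q s) (𝓝 1) (𝓝 (1 * q s)) := tendsto_id.mul_const _
        rw [one_mul] at this
        exact this.mono_left nhdsWithin_le_nhds
      · filter_upwards [hr] with r h
        exact ⟨(hrq h hs).1.le, (hrq h hs).2.trans hs.2⟩
    have hq' : q s ∈ Ico (0 : ℝ) 1 := Ioo_subset_Ico_self hs
    have c := fun v => (continuousOn_theta3 v (q s) hq').tendsto.comp ht
    have c' := fun v => (continuousOn_theta3' v (q s) hq').tendsto.comp ht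
    exact (((c _).sub (c _)).const_mul _).add (((c' _).add (c' _)).const_mul _)

end Interchange

/-! ### The theta terms of the moving strip -/

variable {y z : ℝ → ℝ} {τ : ℝ}

lemma phiPlus_left (ξ : ℝ) : phiPlus y z τ (y τ) ξ = -phiMinus y z τ (y τ) ξ := by
  rw [phiPlus, phiMinus]; ring

lemma phiPlus_right (hl : width y z τ ≠ 0) (ξ : ℝ) :
    phiPlus y z τ (z τ) ξ = -phiMinus y z τ (z τ) ξ + π := by
  rw [phiPlus, phiMinus]
  unfold width at *
  field_simp
  ring

/-- On the lower boundary `φ₊ = -φ₋`, on the upper one `φ₊ = π - φ₋`; evenness and `π`-periodicity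
of `θ₃` cancel the two terms. -/
lemma thetaDiff_eq_zero_of_boundary (hl : width y z τ ≠ 0) {x : ℝ} (hx : x = y τ ∨ x = z τ)
    (s ξ : ℝ) : thetaDiff y z τ s x ξ = 0 := by
  rcases hx with rfl | rfl
  · rw [thetaDiff, phiPlus_left, theta3_neg, sub_self]
  · rw [thetaDiff, phiPlus_right hl, theta3_add_pi, theta3_neg, sub_self]

lemma thetaDerivSum_eq_zero_of_boundary (hl : width y z τ ≠ 0) {x : ℝ} (hx : x = y τ ∨ x = z τ)
    (s ξ : ℝ) : thetaDerivSum y z τ s x ξ = 0 := by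
  rcases hx with rfl | rfl
  · rw [thetaDerivSum, phiPlus_left, theta3'_neg, add_neg_cancel]
  · rw [thetaDerivSum, phiPlus_right hl, theta3'_add_pi, theta3'_neg, add_neg_cancel]

lemma thetaMode_phi (A P x ξ ω : ℝ) (n : ℕ) :
    thetaMode A P (phiMinus y z τ x ξ) (phiPlus y z τ x ξ) ω n =
      4 * sin (π * (n + 1 : ℕ) * ((x - y τ) / width y z τ)) * (ω ^ ((n + 1) ^ 2) *
        (A * sin (π * (n + 1 : ℕ) / width y z τ * (ξ - y τ))
          - 2 * P * ((n : ℝ) + 1) * cos (π * (n + 1 : ℕ) / width y z τ * (ξ - y τ)))) := by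
  have e1 : 2 * ((n : ℝ) + 1) * phiMinus y z τ x ξ =
      π * (n + 1 : ℕ) * ((x - y τ) / width y z τ) - π * (n + 1 : ℕ) / width y z τ * (ξ - y τ) := by
    rw [phiMinus, ← div_div]; push_cast; ring
  have e2 : 2 * ((n : ℝ) + 1) * phiPlus y z τ x ξ =
      π * (n + 1 : ℕ) * ((x - y τ) / width y z τ) + π * (n + 1 : ℕ) / width y z τ * (ξ - y τ) := by
    rw [phiPlus, ← div_div]; push_cast; ring
  rw [thetaMode, e1, e2, cos_sub, cos_add, sin_sub, sin_add]
  ring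

lemma nome_pow (s : ℝ) (m : ℕ) :
    nome y z τ s ^ (m ^ 2) = exp (-(π ^ 2 * (m : ℝ) ^ 2 / width y z τ ^ 2 * (τ - s))) := by
  rw [nome, ← exp_nat_mul]
  push_cast
  congr 1
  ring

lemma sineIntegrand_eq (y z fm fp Ψ Φ : ℝ → ℝ) (τ : ℝ) (n : ℕ) (s : ℝ) :
    sineIntegrand y z fm fp Ψ Φ τ n s =
      exp (-(π ^ 2 * (n : ℝ) ^ 2 / width y z τ ^ 2 * (τ - s))) *
        ((Ψ s - fm s * deriv y s) * sin (π * n / width y z τ * (y s - y τ))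
          + fm s * (π * n / width y z τ) * cos (π * n / width y z τ * (y s - y τ)))
      + exp (-(π ^ 2 * (n : ℝ) ^ 2 / width y z τ ^ 2 * (τ - s))) *
        ((Φ s + fp s * deriv z s) * sin (π * n / width y z τ * (z s - y τ))
          - fp s * (π * n / width y z τ) * cos (π * n / width y z τ * (z s - y τ))) := by
  rw [sineIntegrand, beta]
  ring

lemma thetaIntegrand_eq (y z fm fp Ψ Φ : ℝ → ℝ) (τ x s : ℝ) :
    thetaIntegrand y z fm fp Ψ Φ τ x s =
      thetaPair (Ψ s - fm s * deriv y s) (-(π / (2 * width y z τ)) * fm s)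
        (phiMinus y z τ x (y s)) (phiPlus y z τ x (y s)) (nome y z τ s)
      + thetaPair (Φ s + fp s * deriv z s) (π / (2 * width y z τ) * fp s)
        (phiMinus y z τ x (z s)) (phiPlus y z τ x (z s)) (nome y z τ s) := by
  rw [thetaIntegrand, thetaPair, thetaPair, thetaDiff, thetaDiff, thetaDerivSum, thetaDerivSum]
  ring

/-- Each boundary acts as one source and one dipole: the sine terms are collected in `A`, and the
rebate terms `f πn/l cos` come from `P = ∓ π f/(2l)`. -/
lemma sineIntegrand_eq_thetaMode (hl : width y z τ ≠ 0) (fm fp Ψ Φ : ℝ → ℝ) (n : ℕ) (x s : ℝ) :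
    4 * sin (π * (n + 1 : ℕ) * ((x - y τ) / width y z τ)) *
        sineIntegrand y z fm fp Ψ Φ τ (n + 1) s =
      thetaMode (Ψ s - fm s * deriv y s) (-(π / (2 * width y z τ)) * fm s)
        (phiMinus y z τ x (y s)) (phiPlus y z τ x (y s)) (nome y z τ s) n
      + thetaMode (Φ s + fp s * deriv z s) (π / (2 * width y z τ) * fp s)
        (phiMinus y z τ x (z s)) (phiPlus y z τ x (z s)) (nome y z τ s) n := by
  rw [sineIntegrand_eq, thetaMode_phi, thetaMode_phi, nome_pow]
  push_cast
  field_simp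
  ring

lemma sum_Icc_one_eq_sum_range (f : ℕ → ℝ) (N : ℕ) :
    ∑ n ∈ Finset.Icc 1 N, f n = ∑ n ∈ Finset.range N, f (n + 1) := by
  induction N with
  | zero => simp
  | succ N ih => rw [Finset.sum_Icc_succ_top (by omega), Finset.sum_range_succ, ih]

/-- At `0` and `T` the function is regular only from inside, so `deriv` carries no information
there; it agrees almost everywhere with the continuous one-sided version. -/
lemma intervalIntegrable_deriv {T : ℝ} {f : ℝ → ℝ} (hf : ContDiffOn ℝ 1 f (Icc 0 T))
    (hτ : τ ∈ Ioc 0 T) : IntervalIntegrable (deriv f) volume 0 τ := by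
  have hT : 0 < T := hτ.1.trans_le hτ.2
  have hc : ContinuousOn (derivWithin f (Icc 0 T)) (Icc 0 T) :=
    hf.continuousOn_derivWithin (uniqueDiffOn_Icc hT) le_rfl
  have hI : IntervalIntegrable (derivWithin f (Icc 0 T)) volume 0 τ :=
    ContinuousOn.intervalIntegrable (by
      rw [uIcc_of_le hτ.1.le]
      exact hc.mono (Icc_subset_Icc_right hτ.2))
  refine hI.congr_ae ((ae_restrict_iff' measurableSet_uIoc).2 ?_)
  have hne : ∀ᵐ s : ℝ, s ≠ τ := by simp [ae_iff]
  filter_upwards [hne] with s hs hs'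
  rw [uIoc_of_le hτ.1.le] at hs'
  exact derivWithin_of_mem_nhds
    (Icc_mem_nhds hs'.1 ((lt_of_le_of_ne hs'.2 hs).trans_le hτ.2))

end

/-! ### Sine coefficients of the solution and passage to the theta form -/

section

variable {T τ : ℝ} {y z U₀ fm fp : ℝ → ℝ} {U : ℝ → ℝ → ℝ}

lemma intervalIntegrable_sineIntegrand {Ψ Φ : ℝ → ℝ} (hτ : 0 ≤ τ)
    (hy : ContinuousOn y (Icc 0 τ)) (hz : ContinuousOn z (Icc 0 τ))
    (hfm : ContinuousOn fm (Icc 0 τ)) (hfp : ContinuousOn fp (Icc 0 τ))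
    (hA : IntervalIntegrable (fun s => Ψ s - fm s * deriv y s) volume 0 τ)
    (hB : IntervalIntegrable (fun s => Φ s + fp s * deriv z s) volume 0 τ) (n : ℕ) :
    IntervalIntegrable (sineIntegrand y z fm fp Ψ Φ τ n) volume 0 τ := by
  rw [← uIcc_of_le hτ] at hy hz hfm hfp
  have he : ContinuousOn (fun s => exp (-(π ^ 2 * (n : ℝ) ^ 2 / width y z τ ^ 2 * (τ - s))))
      (uIcc 0 τ) := by fun_prop
  refine IntervalIntegrable.congr (fun s _ => (sineIntegrand_eq y z fm fp Ψ Φ τ n s).symm) ?_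
  refine IntervalIntegrable.add ?_ ?_
  · refine IntervalIntegrable.continuousOn_mul (.add (hA.mul_continuousOn ?_) ?_) he
    · fun_prop
    · refine ContinuousOn.intervalIntegrable ?_
      fun_prop
  · refine IntervalIntegrable.continuousOn_mul (.sub (hB.mul_continuousOn ?_) ?_) he
    · fun_prop
    · refine ContinuousOn.intervalIntegrable ?_
      fun_prop

/-- The braces of the generalized sine series are the sine coefficients of `U(τ, ·)`. -/
lemma IsClassicalSolution.sineCoeff_eq (hU : IsClassicalSolution T y z U₀ fm fp U)
    (hy : ContDiffOn ℝ 1 y (Icc 0 T)) (hz : ContDiffOn ℝ 1 z (Icc 0 T))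
    (hyz : ∀ s ∈ Icc 0 T, y s < z s) (hτ : τ ∈ Ioc 0 T) (n : ℕ)
    (hI : IntervalIntegrable (sineIntegrand y z fm fp (Psi y z U) (Phi y z U) τ n) volume 0 τ) :
    sineCoeff y z U₀ fm fp (Psi y z U) (Phi y z U) τ n =
      ∫ ξ in y τ..z τ, U τ ξ * sin (π * n / (z τ - y τ) * (ξ - y τ)) := by
  have e : ∀ t : ℝ, π ^ 2 * (n : ℝ) ^ 2 / width y z τ ^ 2 * t = (π * n / width y z τ) ^ 2 * t :=
    fun t => by ring
  have h := hU.green hy hz hyz hτ (π * n / width y z τ) (fun s _ => by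
    rw [sineIntegrand, beta, e]) hI
  rw [sineCoeff, e, ← h, width]

section Theta

variable {Ψ Φ : ℝ → ℝ} {x : ℝ}

/-- At `s = τ` the source sits on the boundary while `x` is interior, so `0 < |φ₋| < π` and `0 < φ₊
< π`: neither argument tends to a point of `πℤ`. -/
lemma exists_bound_theta_phi {η : ℝ → ℝ} (hτ : 0 ≤ τ) (hl : 0 < width y z τ)
    (hη : ContinuousOn η (Icc 0 τ)) (hητ : η τ = y τ ∨ η τ = z τ) (hx : x ∈ Ioo (y τ) (z τ)) :
    ∃ C, ∀ s ∈ Ico 0 τ, ∀ ω ∈ Icc 0 (nome y z τ s),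
      (|theta3 (phiMinus y z τ x (η s)) ω| ≤ C ∧ |theta3' (phiMinus y z τ x (η s)) ω| ≤ C) ∧
      (|theta3 (phiPlus y z τ x (η s)) ω| ≤ C ∧ |theta3' (phiPlus y z τ x (η s)) ω| ≤ C) := by
  have hκ : 0 < π ^ 2 / width y z τ ^ 2 := by have := pi_pos; positivity
  have hn : ∀ s, nome y z τ s = exp (-(π ^ 2 / width y z τ ^ 2 * (τ - s))) := fun s => by
    rw [nome]; ring_nf
  have hη' := hη τ ⟨hτ, le_rfl⟩
  have hl' : width y z τ = z τ - y τ := rfl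
  have h2l : 0 < 2 * width y z τ := by linarith
  have hlt : ∀ u, |u| < 2 * width y z τ → |π * u / (2 * width y z τ)| < π := fun u hu => by
    rw [abs_div, abs_mul, abs_of_pos pi_pos, abs_of_pos h2l, div_lt_iff₀ h2l]
    exact mul_lt_mul_of_pos_left hu pi_pos
  have hne : ∀ u, u ≠ 0 → π * u / (2 * width y z τ) ≠ 0 := fun u hu =>
    div_ne_zero (mul_ne_zero pi_ne_zero hu) h2l.ne'
  obtain ⟨C₁, h₁⟩ := exists_bound_theta_path (v := fun s => phiMinus y z τ x (η s)) hκ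
    (ContinuousWithinAt.div_const (continuousWithinAt_const.mul
      (continuousWithinAt_const.sub hη')) _)
    (hne _ (by rcases hητ with h | h <;> rw [h] <;> [exact sub_ne_zero.2 hx.1.ne'; exact
      sub_ne_zero.2 hx.2.ne]))
    (hlt _ (by rw [abs_lt]; rcases hητ with h | h <;> rw [h] <;> constructor <;>
      linarith [hx.1, hx.2]))
  obtain ⟨C₂, h₂⟩ := exists_bound_theta_path (v := fun s => phiPlus y z τ x (η s)) hκ
    (ContinuousWithinAt.div_const (continuousWithinAt_const.mul
      ((continuousWithinAt_const.add hη').sub continuousWithinAt_const)) _)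
    (hne _ (ne_of_gt (by rcases hητ with h | h <;> rw [h] <;> linarith [hx.1, hx.2])))
    (hlt _ (by rw [abs_lt]; rcases hητ with h | h <;> rw [h] <;> constructor <;>
      linarith [hx.1, hx.2]))
  refine ⟨max C₁ C₂, fun s hs ω hω => ?_⟩
  rw [hn] at hω
  obtain ⟨a, b⟩ := h₁ s hs ω hω
  obtain ⟨c, d⟩ := h₂ s hs ω hω
  exact ⟨⟨a.trans (le_max_left _ _), b.trans (le_max_left _ _)⟩,
    c.trans (le_max_right _ _), d.trans (le_max_right _ _)⟩

/-- Summing the generalized sine series under the integral signs gives the theta form. -/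
lemma theta_form_of_sine_series (hτ : 0 < τ) (hl : 0 < width y z τ) (h0 : y 0 ≤ z 0)
    (hx : x ∈ Ioo (y τ) (z τ))
    (hy : ContinuousOn y (Icc 0 τ)) (hz : ContinuousOn z (Icc 0 τ))
    (hfm : ContinuousOn fm (Icc 0 τ)) (hfp : ContinuousOn fp (Icc 0 τ))
    (hU₀ : IntervalIntegrable U₀ volume (y 0) (z 0))
    (hA : IntervalIntegrable (fun s => Ψ s - fm s * deriv y s) volume 0 τ)
    (hB : IntervalIntegrable (fun s => Φ s + fp s * deriv z s) volume 0 τ) {S : ℝ}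
    (hS : Tendsto (fun N : ℕ => ∑ n ∈ Finset.range N,
      4 * (sin (π * (n + 1 : ℕ) * ((x - y τ) / width y z τ)) *
        sineCoeff y z U₀ fm fp Ψ Φ τ (n + 1))) atTop (𝓝 S)) :
    IntervalIntegrable (fun ξ => U₀ ξ * thetaDiff y z τ 0 x ξ) volume (y 0) (z 0) ∧
      IntervalIntegrable (thetaIntegrand y z fm fp Ψ Φ τ x) volume 0 τ ∧
      S = (∫ ξ in (y 0)..(z 0), U₀ ξ * thetaDiff y z τ 0 x ξ)
          + ∫ s in (0 : ℝ)..τ, thetaIntegrand y z fm fp Ψ Φ τ x s := by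
  have hSI : ∀ n, IntervalIntegrable (sineIntegrand y z fm fp Ψ Φ τ n) volume 0 τ :=
    intervalIntegrable_sineIntegrand hτ.le hy hz hfm hfp hA hB
  rw [intervalIntegrable_iff_integrableOn_Ioc_of_le h0] at hU₀
  have hI : ∀ f : ℝ → ℝ, IntervalIntegrable f volume 0 τ ↔ IntegrableOn f (Ioc 0 τ) := fun f =>
    intervalIntegrable_iff_integrableOn_Ioc_of_le hτ.le
  have hA' := (hI _).1 hA
  have hB' := (hI _).1 hB
  have hm : ∀ {f : ℝ → ℝ}, ContinuousOn f (Icc 0 τ) →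
      AEMeasurable f (volume.restrict (Ioc 0 τ)) := fun hf =>
    (hf.mono Ioc_subset_Icc_self).aemeasurable measurableSet_Ioc
  have hP : IntegrableOn (fun s => -(π / (2 * width y z τ)) * fm s) (Ioc 0 τ) :=
    ((hfm.integrableOn_Icc).mono_set Ioc_subset_Icc_self).const_mul _
  have hQ : IntegrableOn (fun s => π / (2 * width y z τ) * fp s) (Ioc 0 τ) :=
    ((hfp.integrableOn_Icc).mono_set Ioc_subset_Icc_self).const_mul _
  have hq : AEMeasurable (nome y z τ) (volume.restrict (Ioc 0 τ)) :=
    Continuous.aemeasurable (by unfold nome; fun_prop)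
  have hpi := pi_pos
  have hn01 : ∀ s, s < τ → nome y z τ s ∈ Ioo (0 : ℝ) 1 := fun s hs =>
    ⟨exp_pos _, exp_lt_one_iff.2 (by have := sub_pos.2 hs; rw [neg_lt_zero]; positivity)⟩
  have hae : ∀ᵐ s ∂(volume.restrict (Ioc 0 τ)), s ∈ Ico 0 τ := by
    refine (ae_restrict_iff' measurableSet_Ioc).2 ?_
    have hne : ∀ᵐ s : ℝ, s ≠ τ := by simp [ae_iff]
    filter_upwards [hne] with s hs hs' using ⟨hs'.1.le, lt_of_le_of_ne hs'.2 hs⟩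
  have hq01 : ∀ᵐ s ∂(volume.restrict (Ioc 0 τ)), nome y z τ s ∈ Ioo (0 : ℝ) 1 :=
    hae.mono fun s hs => hn01 s hs.2
  have hvm : ∀ {η : ℝ → ℝ}, ContinuousOn η (Icc 0 τ) →
      AEMeasurable (fun s => phiMinus y z τ x (η s)) (volume.restrict (Ioc 0 τ)) := fun hη => by
    have := hm hη
    unfold phiMinus
    fun_prop
  have hvp : ∀ {η : ℝ → ℝ}, ContinuousOn η (Icc 0 τ) →
      AEMeasurable (fun s => phiPlus y z τ x (η s)) (volume.restrict (Ioc 0 τ)) := fun hη => by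
    have := hm hη
    unfold phiPlus
    fun_prop
  obtain ⟨Cy, hCy⟩ := exists_bound_theta_phi hτ.le hl hy (Or.inl rfl) hx
  obtain ⟨Cz, hCz⟩ := exists_bound_theta_phi hτ.le hl hz (Or.inr rfl) hx
  have iy := integrable_thetaPair hA' hP (hvm hy) (hvp hy) hq hq01
    (hae.mono fun s hs ω hω => (hCy s hs ω hω).1) (hae.mono fun s hs ω hω => (hCy s hs ω hω).2)
  have iz := integrable_thetaPair hB' hQ (hvm hz) (hvp hz) hq hq01
    (hae.mono fun s hs ω hω => (hCz s hs ω hω).1) (hae.mono fun s hs ω hω => (hCz s hs ω hω).2)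
  have ty := tendsto_integral_thetaPair hA' hP (hvm hy) (hvp hy) hq hq01
    (hae.mono fun s hs ω hω => (hCy s hs ω hω).1) (hae.mono fun s hs ω hω => (hCy s hs ω hω).2)
  have tz := tendsto_integral_thetaPair hB' hQ (hvm hz) (hvp hz) hq hq01
    (hae.mono fun s hs ω hω => (hCz s hs ω hω).1) (hae.mono fun s hs ω hω => (hCz s hs ω hω).2)
  -- The initial integral is a pair without dipole at the constant nome `ω₁ < 1`, where the
  -- elementary bound suffices.
  have hq0 := hn01 0 hτ
  obtain ⟨C₀, hC₀⟩ := exists_bound_theta_of_le hq0.1.le hq0.2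
  have hP0 : Integrable (fun _ : ℝ => (0 : ℝ)) (volume.restrict (Ioc (y 0) (z 0))) :=
    integrable_zero _ _ _
  have hv0m : AEMeasurable (fun ξ => phiMinus y z τ x ξ) (volume.restrict (Ioc (y 0) (z 0))) :=
    Continuous.aemeasurable (by unfold phiMinus; fun_prop)
  have hv0p : AEMeasurable (fun ξ => phiPlus y z τ x ξ) (volume.restrict (Ioc (y 0) (z 0))) :=
    Continuous.aemeasurable (by unfold phiPlus; fun_prop)
  have hc0 : AEMeasurable (fun _ : ℝ => nome y z τ 0) (volume.restrict (Ioc (y 0) (z 0))) :=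
    aemeasurable_const
  have hc01 : ∀ᵐ _ξ ∂(volume.restrict (Ioc (y 0) (z 0))), nome y z τ 0 ∈ Ioo (0 : ℝ) 1 :=
    Eventually.of_forall fun _ => hq0
  have i0 := integrable_thetaPair hU₀ hP0 hv0m hv0p hc0 hc01
    (Eventually.of_forall fun ξ ω hω => hC₀ _ ω hω) (Eventually.of_forall fun ξ ω hω => hC₀ _ ω hω)
  have t0 := tendsto_integral_thetaPair hU₀ hP0 hv0m hv0p hc0 hc01
    (Eventually.of_forall fun ξ ω hω => hC₀ _ ω hω) (Eventually.of_forall fun ξ ω hω => hC₀ _ ω hω)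
  have e0 : ∀ ξ, thetaPair (U₀ ξ) 0 (phiMinus y z τ x ξ) (phiPlus y z τ x ξ) (nome y z τ 0)
      = U₀ ξ * thetaDiff y z τ 0 x ξ := fun ξ => by
    rw [thetaPair, thetaDiff, zero_mul, add_zero]
  have eS : thetaIntegrand y z fm fp Ψ Φ τ x = fun s => _ :=
    funext fun s => thetaIntegrand_eq y z fm fp Ψ Φ τ x s
  refine ⟨?_, ?_, ?_⟩
  · rw [intervalIntegrable_iff_integrableOn_Ioc_of_le h0]
    simp_rw [e0] at i0
    exact i0
  · rw [hI, eS]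
    exact iy.add iz
  rw [intervalIntegral.integral_of_le h0, intervalIntegral.integral_of_le hτ.le, eS,
    integral_add iy iz, ← integral_congr_ae (Eventually.of_forall e0)]
  -- Both sides are limits as `r → 1⁻` of the same regularized quantity: Abel's theorem on the
  -- series, dominated convergence on the integrals.
  refine tendsto_nhds_unique (tendsto_tsum_pow_sq_mul hS) ((t0.add (ty.add tz)).congr' ?_)
  filter_upwards [Ioo_mem_nhdsLT (one_pos (α := ℝ))] with r hr
  have s0 := hasSum_integral_thetaMode hU₀ hP0 hv0m hv0p hc0 hc01 hr
  have sy := hasSum_integral_thetaMode hA' hP (hvm hy) (hvp hy) hq hq01 hr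
  have sz := hasSum_integral_thetaMode hB' hQ (hvm hz) (hvp hz) hq hq01 hr
  rw [← (s0.add (sy.add sz)).tsum_eq]
  refine tsum_congr fun n => ?_
  rw [← mul_add, ← mul_add, ← integral_add
    (integrable_thetaMode hA' hP (hvm hy) (hvp hy) hq hq01 n)
    (integrable_thetaMode hB' hQ (hvm hz) (hvp hz) hq hq01 n)]
  congr 1
  simp_rw [← sineIntegrand_eq_thetaMode hl.ne', thetaMode_phi, nome_pow]
  rw [integral_const_mul, integral_const_mul, integral_const_mul, sineCoeff,
    intervalIntegral.integral_of_le h0, intervalIntegral.integral_of_le hτ.le]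
  simp only [mul_zero, zero_mul, sub_zero]
  ring

end Theta

end

end MovingStrip

/-! ### The two representations -/

theorem mainTheorem1 (T : ℝ) (y z U₀ fm fp : ℝ → ℝ) (U : ℝ → ℝ → ℝ)
    (hy : ContDiffOn ℝ 1 y (Set.Icc 0 T)) (hz : ContDiffOn ℝ 1 z (Set.Icc 0 T))
    (hyz : ∀ τ ∈ Set.Icc 0 T, y τ < z τ)
    (hfm : ContinuousOn fm (Set.Icc 0 T)) (hfp : ContinuousOn fp (Set.Icc 0 T))
    (hU : MovingStrip.IsClassicalSolution T y z U₀ fm fp U)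
    (hΨ : IntervalIntegrable (MovingStrip.Psi y z U) MeasureTheory.volume 0 T)
    (hΦ : IntervalIntegrable (MovingStrip.Phi y z U) MeasureTheory.volume 0 T)
    (τ : ℝ) (hτ : τ ∈ Set.Ioc 0 T) (x : ℝ) (hx : x ∈ Set.Icc (y τ) (z τ)) :
    -- the generalized Fourier sine series
    (IntervalIntegrable U₀ MeasureTheory.volume (y 0) (z 0) ∧
      (∀ n : ℕ, IntervalIntegrable
        (MovingStrip.sineIntegrand y z fm fp (MovingStrip.Psi y z U) (MovingStrip.Phi y z U) τ n)
        MeasureTheory.volume 0 τ) ∧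
      Filter.Tendsto
        (fun N : ℕ =>
          2 / MovingStrip.width y z τ *
              ∑ n ∈ Finset.Icc 1 N,
                Real.sin (Real.pi * n * ((x - y τ) / MovingStrip.width y z τ)) *
                  MovingStrip.sineCoeff y z U₀ fm fp
                    (MovingStrip.Psi y z U) (MovingStrip.Phi y z U) τ n
            + MovingStrip.boundaryTerm y z fm fp τ x)
        Filter.atTop (nhds (U τ x))) ∧
    -- the theta function form
    (IntervalIntegrable (fun ξ => U₀ ξ * MovingStrip.thetaDiff y z τ 0 x ξ)
        MeasureTheory.volume (y 0) (z 0) ∧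
      IntervalIntegrable
        (MovingStrip.thetaIntegrand y z fm fp (MovingStrip.Psi y z U) (MovingStrip.Phi y z U) τ x)
        MeasureTheory.volume 0 τ ∧
      2 * MovingStrip.width y z τ * (U τ x - MovingStrip.boundaryTerm y z fm fp τ x) =
        (∫ ξ in (y 0)..(z 0), U₀ ξ * MovingStrip.thetaDiff y z τ 0 x ξ)
          + ∫ s in (0 : ℝ)..τ, MovingStrip.thetaIntegrand y z fm fp
              (MovingStrip.Psi y z U) (MovingStrip.Phi y z U) τ x s) := by
  have hT : 0 < T := hτ.1.trans_le hτ.2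
  have hτT : τ ∈ Set.Icc 0 T := Set.Ioc_subset_Icc_self hτ
  have hsub : Set.Icc 0 τ ⊆ Set.Icc 0 T := Set.Icc_subset_Icc_right hτ.2
  have hl : 0 < MovingStrip.width y z τ := sub_pos.2 (hyz τ hτT)
  have h0 : y 0 < z 0 := hyz 0 ⟨le_rfl, hT.le⟩
  have hy' := hy.continuousOn.mono hsub
  have hz' := hz.continuousOn.mono hsub
  have hfm' := hfm.mono hsub
  have hfp' := hfp.mono hsub
  have husub : Set.uIcc 0 τ ⊆ Set.uIcc 0 T := by
    rwa [Set.uIcc_of_le hτ.1.le, Set.uIcc_of_le hT.le]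
  have hU₀ := hU.intervalIntegrable_initial hT hy.continuousOn hz.continuousOn hyz
  have hA : IntervalIntegrable (fun s => MovingStrip.Psi y z U s - fm s * deriv y s)
      MeasureTheory.volume 0 τ :=
    (hΨ.mono_set husub).sub ((MovingStrip.intervalIntegrable_deriv hy hτ).continuousOn_mul
      (by rwa [Set.uIcc_of_le hτ.1.le]))
  have hB : IntervalIntegrable (fun s => MovingStrip.Phi y z U s + fp s * deriv z s)
      MeasureTheory.volume 0 τ :=
    (hΦ.mono_set husub).add ((MovingStrip.intervalIntegrable_deriv hz hτ).continuousOn_mul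
      (by rwa [Set.uIcc_of_le hτ.1.le]))
  have hSI := MovingStrip.intervalIntegrable_sineIntegrand hτ.1.le hy' hz' hfm' hfp' hA hB
  have hcoeff := fun n => hU.sineCoeff_eq hy hz hyz hτ n (hSI n)
  -- On the boundary all sine and theta terms vanish and `F = U`; inside, `F = 0` and the sine
  -- series of `U(τ, ·)` converges to it.
  by_cases hxb : x = y τ ∨ x = z τ
  · have hF : MovingStrip.boundaryTerm y z fm fp τ x = U τ x := by
      rcases hxb with rfl | rfl
      · rw [MovingStrip.boundaryTerm, if_pos rfl, hU.lower τ hτ]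
      · rw [MovingStrip.boundaryTerm, if_neg (hyz τ hτT).ne', if_pos rfl, hU.upper τ hτ]
    have hsin : ∀ n : ℕ,
        Real.sin (Real.pi * n * ((x - y τ) / MovingStrip.width y z τ)) = 0 := by
      intro n
      rcases hxb with rfl | rfl
      · simp
      · rw [← MovingStrip.width, div_self hl.ne', mul_one, mul_comm]
        exact Real.sin_nat_mul_pi n
    have hTD := MovingStrip.thetaDiff_eq_zero_of_boundary hl.ne' hxb
    have hDS := MovingStrip.thetaDerivSum_eq_zero_of_boundary hl.ne' hxb
    have hTI : ∀ s, MovingStrip.thetaIntegrand y z fm fp (MovingStrip.Psi y z U)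
        (MovingStrip.Phi y z U) τ x s = 0 := fun s => by
      simp [MovingStrip.thetaIntegrand, hTD, hDS]
    refine ⟨⟨hU₀, hSI, ?_⟩, ?_, ?_, ?_⟩
    · simp [hsin, hF]
    · simp [hTD]
    · rw [show MovingStrip.thetaIntegrand y z fm fp (MovingStrip.Psi y z U)
        (MovingStrip.Phi y z U) τ x = fun _ => 0 from funext hTI]
      simp
    · simp [hTD, hTI, hF]
  · have hxi : x ∈ Set.Ioo (y τ) (z τ) :=
      ⟨lt_of_le_of_ne hx.1 fun h => hxb (Or.inl h.symm),
        lt_of_le_of_ne hx.2 fun h => hxb (Or.inr h)⟩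
    have hF : MovingStrip.boundaryTerm y z fm fp τ x = 0 := by
      rw [MovingStrip.boundaryTerm, if_neg fun h => hxb (Or.inl h), if_neg fun h => hxb (Or.inr h)]
    have hUc : ContinuousOn (U τ) (Set.Icc (y τ) (z τ)) := fun u hu =>
      (hU.differentiableWithinAt (τ, u) ⟨hτ.1, hτ.2, hu.1, hu.2⟩).continuousWithinAt
    have hser := MovingStrip.tendsto_sine_series (U τ) (y τ) (z τ) x hxi hUc
      (hU.hasDerivAt_space hτ hxi).differentiableAt
    simp_rw [← hcoeff] at hser
    change Filter.Tendsto (fun N : ℕ => 2 / MovingStrip.width y z τ * ∑ n ∈ Finset.Icc 1 N,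
      Real.sin (Real.pi * n * ((x - y τ) / MovingStrip.width y z τ)) * _) _ _ at hser
    -- `2l · (2/l) = 4` is the factor in front of the modes in `thetaMode_phi`.
    have hS := hser.const_mul (2 * MovingStrip.width y z τ)
    have hth := MovingStrip.theta_form_of_sine_series hτ.1 hl h0.le hxi hy' hz' hfm' hfp' hU₀ hA hB
      (hS.congr fun N => by
        rw [MovingStrip.sum_Icc_one_eq_sum_range, ← Finset.mul_sum, ← mul_assoc]
        congr 1
        field_simp
        ring)
    refine ⟨⟨hU₀, hSI, ?_⟩, ?_⟩
    · simpa [hF] using hser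
    · rw [hF, sub_zero]
      exact hth
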